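/- Let $\rho>0$ and let $(E_i)_{i\ge 1}$ be i.i.d. exponential random variables with parameter $1$. Put $t_0=0$ and \[ t_n=\sum_{i=1}^n \frac{E_i}{i},\qquad P_n=e^{-\rho t_{n-1}}-e^{-\rho t_n}\qquad(n\ge 1), \] so that $P_n$ is the conditional probability, given $(t_k)$, that an independent exponential random variable with parameter $\rho$ falls into the $n$th bin $(t_{n-1},t_n]$. Let $M_n=t_n-\log n$. Then $M_n$ converges almost surely to a finite random variable $M_\infty$; put $W_\infty=e^{-M_\infty}$. For $n\ge 1$ let ${\mathcal P}_n$ be the point process on ${\mathbb R}_+^2=[0,\infty)^2$ with points $\left(i/n^{1/(\rho+2)},\,nP_i\right)$, $i\ge 1$, and write ${\mathcal P}_n(f)=\sum_{i\ge 1} f\left(i/n^{1/(\rho+2)},nP_i\right)$. Let $f:{\mathbb R}_+^2\to{\mathbb R}_+$ be a continuous function such that 1. there exists $K$ such that $f(x,y)=0$ for all $x\ge K$ and $y\in{\mathbb R}_+$; 2. for all $x\in{\mathbb R}_+$ the function $y\mapsto f(x,y)$ is differentiable on ${\mathbb R}_+$ (one-sidedly at $0$), and \[ y\longmapsto y\,\sup_{x\in{\mathbb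 R}_+}\left|\frac{\partial f}{\partial y}(x,y)\right| \] is integrable on ${\mathbb R}_+$. Then \[ \lim_{n\to+\infty}{\mathbb E}\left(e^{-{\mathcal P}_n(f)}\right)={\mathbb E}\left[\exp\left(-\frac{W_\infty^{-\rho}}{\rho}\int_{{\mathbb R}_+^2}\left(1-e^{-f(x,y)}\right)x^{\rho+1}\,dx\,dy\right)\right], \] where the integral on the right takes values in $[0,+\infty]$ and $e^{-\infty}=0$. -/

import Mathlib

open MeasureTheory ProbabilityTheory Filter Topology
open scoped ENNReal

noncomputable section

namespace YuleBins

variable {Ω : Type*}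

/-- The split times `t_n = ∑_{k=1}^n E_k / k`. The sequence `E_1, E_2, …` is indexed from `0`:
`E i` stands for `E_{i+1}`. -/
def splitTime (E : ℕ → Ω → ℝ) (n : ℕ) (ω : Ω) : ℝ :=
  ∑ i ∈ Finset.range n, E i ω / ((i : ℝ) + 1)

/-- `P_{i+1} = exp (-ρ t_i) - exp (-ρ t_{i+1})`, the conditional probability, given the split times,
that a ball located at an exponential variable of parameter `ρ` falls into the bin
`(t_i, t_{i+1}]`; see `expMeasure_real_bin`. -/
def binProb (ρ : ℝ) (E : ℕ → Ω → ℝ) (i : ℕ) (ω : Ω) : ℝ :=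
  Real.exp (-(ρ * splitTime E i ω)) - Real.exp (-(ρ * splitTime E (i + 1) ω))

/-- `binProb` is the mass that the law of a ball gives to the bin. -/
theorem expMeasure_real_bin {ρ : ℝ} (hρ : 0 < ρ) (E : ℕ → Ω → ℝ) (i : ℕ) (ω : Ω)
    (hE : ∀ k, 0 ≤ E k ω) :
    (expMeasure ρ).real (Set.Ioc (splitTime E i ω) (splitTime E (i + 1) ω)) =
      binProb ρ E i ω := by
  have : IsProbabilityMeasure (expMeasure ρ) := isProbabilityMeasure_expMeasure hρ
  have h0 : ∀ n, 0 ≤ splitTime E n ω := fun n =>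
    Finset.sum_nonneg fun k _ => div_nonneg (hE k) (by positivity)
  have hle : splitTime E i ω ≤ splitTime E (i + 1) ω := by
    simp only [splitTime, Finset.sum_range_succ]
    have : 0 ≤ E i ω / ((i : ℝ) + 1) := div_nonneg (hE i) (by positivity)
    linarith
  rw [← Set.Iic_sdiff_Iic, measureReal_sdiff (Set.Iic_subset_Iic.2 hle) measurableSet_Iic,
    ← cdf_eq_real, ← cdf_eq_real, cdf_expMeasure_eq hρ, cdf_expMeasure_eq hρ, if_pos (h0 _),
    if_pos (h0 _), binProb]
  ring

/-- `M_n = t_n - log n`. -/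
def martingaleM (E : ℕ → Ω → ℝ) (n : ℕ) (ω : Ω) : ℝ :=
  splitTime E n ω - Real.log n

/-- `M_∞ = lim M_n`. -/
def limitM (E : ℕ → Ω → ℝ) (ω : Ω) : ℝ :=
  limUnder atTop fun n : ℕ => martingaleM E n ω

/-- `W_∞ = exp (-M_∞)`. -/
def limitW (E : ℕ → Ω → ℝ) (ω : Ω) : ℝ :=
  Real.exp (-limitM E ω)

/-- The point process `{(i / n^{1/(ρ+2)}, n P_i), i ≥ 1}`, as the sum of the Dirac masses at its
points. -/
def pointProcess (ρ : ℝ) (E : ℕ → Ω → ℝ) (n : ℕ) (ω : Ω) : Measure (ℝ × ℝ) :=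
  Measure.sum fun i : ℕ =>
    Measure.dirac (((i : ℝ) + 1) / (n : ℝ) ^ (1 / (ρ + 2)), (n : ℝ) * binProb ρ E i ω)

/-- `exp (-a)` for `a ∈ [0, ∞]`, with `exp (-∞) = 0`. -/
def expNeg (a : ℝ≥0∞) : ℝ :=
  if a = ∞ then 0 else Real.exp (-a.toReal)

/-- The closed quadrant `ℝ₊²`. -/
def quadrant : Set (ℝ × ℝ) := Set.Ici 0 ×ˢ Set.Ici 0

/-- The Laplace functional `𝔼 (exp (-N(f)))` of a random measure `N`, for `f ≥ 0`. -/
def laplaceFunctional [MeasurableSpace Ω] (μ : Measure Ω) (N : Ω → Measure (ℝ × ℝ))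
    (f : ℝ × ℝ → ℝ) : ℝ :=
  ∫ ω, expNeg (∫⁻ p, ENNReal.ofReal (f p) ∂(N ω)) ∂μ

/-- `∫_{ℝ₊²} (1 - exp (-f(x,y))) x^{ρ+1} dx dy ∈ [0, ∞]`, for `f ≥ 0`. -/
def intensityIntegral (ρ : ℝ) (f : ℝ × ℝ → ℝ) : ℝ≥0∞ :=
  ∫⁻ p in quadrant, ENNReal.ofReal ((1 - Real.exp (-f p)) * p.1 ^ (ρ + 1))

/-- `‖∂f/∂y‖_y = sup_{x ≥ 0} |∂f/∂y (x,y)| ∈ [0, ∞]`, the derivative at `y = 0` being one-sided. -/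
def supDeriv (f : ℝ × ℝ → ℝ) (y : ℝ) : ℝ≥0∞ :=
  ⨆ x ∈ Set.Ici (0 : ℝ), ‖derivWithin (fun z => f (x, z)) (Set.Ici 0) y‖ₑ

end YuleBins

end

/-! Write `h = 1 - exp (-f)` and `N = n^{1/(ρ+2)}`, so that the Laplace functional is the
expectation of the product of the factors `Z i = 1 - h` over the points. Given the past, the bin
starts at `t_i`, and `n P_{i+1} = l (1 - exp (-u/p))` with `l = n exp (-ρ t_i)`, `p = (i+1)/ρ` and
`u` exponential. For large `l/p` this variable has density close to the constant `p/l` on compact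
sets. Since `N^{ρ+2} = n`, with `x = (i+1)/N` this constant equals `N⁻¹ x^{ρ+1}/ρ * exp (ρ (t_i -
log (i+1)))`. The conditional mean of `Z i` is thus nearly `exp (-d_i)`, where the `d_i` form a
Riemann sum of `exp (ρ M_∞)/ρ * ∫∫ h x^{ρ+1}`, and `exp (ρ M_∞) = W_∞^{-ρ}`.

The obstacle is that `M_∞` is not known at time `i`. It is replaced by the centred time at a fixed
index `m`: the first `m` factors tend to `1` because `n P_i → ∞`, and the later conditional means
are compared with factors known at time `m`. `abs_integral_prod_sub_le` turns closeness of
conditional means into closeness of expected products, by a telescoping sum stopped before the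
accumulated error exceeds `ε`. Then `n → ∞` and `m → ∞`, which gives
`tendsto_integral_prod_pointFactor`.

This needs an integrable envelope of `h` in `y`. If the intensity integral is finite, condition 2
provides one (`exists_isDominated`): `f(x, y)` is at most the tail integral of the derivative, since
otherwise `f` would stay bounded below on a strip of infinite mass. If it is infinite, truncating
`f` in `y` bounds the Laplace functional by quantities with arbitrarily small limits
(`tendsto_laplaceFunctional_of_eq_top`). -/

noncomputable section

namespace YuleBins

/-! ### Comparing expected products through conditional means -/

section Comparison

variable {Ω : Type*} {mΩ : MeasurableSpace Ω} {μ : Measure Ω}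

/-- Freezing lemma: if `X` is independent of `m` then the `X`-variable of a function of an
`m`-measurable variable and `X` can be integrated out. -/
theorem integral_mul_comp_of_indep {m mΩ : MeasurableSpace Ω} {μ : Measure Ω}
    [IsProbabilityMeasure μ] (hm : m ≤ mΩ) {G T X : Ω → ℝ} (hG : Measurable[m] G) (hT : Measurable[m] T) (hX : Measurable X)
    (hind : Indep m (MeasurableSpace.comap X inferInstance) μ)
    {φ : ℝ → ℝ → ℝ} (hφ : Measurable (Function.uncurry φ))
    (hG1 : ∀ ω, |G ω| ≤ 1) (hφ1 : ∀ s u, |φ s u| ≤ 1) :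
    ∫ ω, G ω * φ (T ω) (X ω) ∂μ = ∫ ω, G ω * ∫ u, φ (T ω) u ∂(μ.map X) ∂μ := by
  have hGT : Measurable[m] fun ω => (G ω, T ω) := hG.prodMk hT
  have hGT' : Measurable fun ω => (G ω, T ω) := hGT.mono hm le_rfl
  have hI : IndepFun (fun ω => (G ω, T ω)) X μ := by
    rw [IndepFun_iff_Indep]
    exact indep_of_indep_of_le_left hind hGT.comap_le
  have hprod := (indepFun_iff_map_prod_eq_prod_map_map hGT'.aemeasurable hX.aemeasurable).1 hI
  have : IsProbabilityMeasure (μ.map X) := Measure.isProbabilityMeasure_map hX.aemeasurable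
  have : IsProbabilityMeasure (μ.map fun ω => (G ω, T ω)) :=
    Measure.isProbabilityMeasure_map hGT'.aemeasurable
  -- clip the first factor so that the integrand is bounded
  let ψ : (ℝ × ℝ) × ℝ → ℝ := fun p => max (-1) (min 1 p.1.1) * φ p.1.2 p.2
  have hφ' : Measurable fun p : (ℝ × ℝ) × ℝ => φ p.1.2 p.2 :=
    hφ.comp ((measurable_snd.comp measurable_fst).prodMk measurable_snd)
  have hψ : Measurable ψ := by
    refine Measurable.mul ?_ hφ'
    fun_prop
  have hψ1 : ∀ p, ‖ψ p‖ ≤ 1 := by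
    intro p
    rw [Real.norm_eq_abs, abs_mul]
    have : |max (-1) (min 1 p.1.1)| ≤ 1 := by
      rw [abs_le]
      exact ⟨le_max_left _ _, max_le (by norm_num) (min_le_left _ _)⟩
    exact mul_le_one₀ this (abs_nonneg _) (hφ1 _ _)
  have hclip : ∀ ω, max (-1) (min 1 (G ω)) = G ω := by
    intro ω
    have := abs_le.1 (hG1 ω)
    rw [min_eq_right this.2, max_eq_right this.1]
  calc ∫ ω, G ω * φ (T ω) (X ω) ∂μ
      = ∫ ω, ψ ((G ω, T ω), X ω) ∂μ := by simp only [ψ, hclip]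
    _ = ∫ p, ψ p ∂(μ.map fun ω => ((G ω, T ω), X ω)) :=
        (integral_map (hGT'.prodMk hX).aemeasurable hψ.aestronglyMeasurable).symm
    _ = ∫ p, ∫ u, ψ (p, u) ∂(μ.map X) ∂(μ.map fun ω => (G ω, T ω)) := by
        rw [hprod, integral_prod]
        exact Integrable.of_bound hψ.aestronglyMeasurable 1 (Eventually.of_forall hψ1)
    _ = ∫ ω, ∫ u, ψ ((G ω, T ω), u) ∂(μ.map X) ∂μ :=
        integral_map hGT'.aemeasurable
          hψ.stronglyMeasurable.integral_prod_right'.aestronglyMeasurable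
    _ = _ := by simp only [ψ, hclip, integral_const_mul]

/-- Monotonicity of `S` makes the indicators equal to `1` up to some index and `0` afterwards, so
the sum telescopes up to that stopping index `j`. -/
theorem exists_sum_mul_sub_eq {m L : ℕ} {ε : ℝ} {S W : ℕ → ℝ} (hS : Monotone S)
    (k : ℕ) (hmk : m ≤ k) (hkL : k ≤ L) :
    ∃ j ∈ Finset.Icc m L, (∑ i ∈ Finset.Ico m k, (if S i ≤ ε then 1 else 0) * (W (i + 1) - W i)
      = W j - W m) ∧ ((∀ i, m ≤ i → i < k → S i ≤ ε) → j = k) := by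
  induction k, hmk using Nat.le_induction with
  | base => exact ⟨m, by simp; omega, by simp, fun _ => rfl⟩
  | succ k hmk ih =>
    obtain ⟨j, hj, hsum, hjk⟩ := ih (by omega)
    rw [Finset.sum_Ico_succ_top hmk, hsum]
    by_cases h : S k ≤ ε
    · have : j = k := hjk fun i _ hi => (hS hi.le).trans h
      subst this
      exact ⟨j + 1, by simp; omega, by simp [h], fun _ => rfl⟩
    · exact ⟨j, hj, by simp [h], fun h' => absurd (h' k hmk (by omega)) h⟩

/-- The indicator at `i` tests the partial sum that already includes `b i`, so the retained total
never overshoots `ε`. -/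
theorem sum_ite_mul_le {m L : ℕ} {ε : ℝ} (hε : 0 ≤ ε) {b : ℕ → ℝ} (hb : ∀ i, 0 ≤ b i) :
    ∑ i ∈ Finset.Ico m L, (if ∑ j ∈ Finset.Ico m (i + 1), b j ≤ ε then 1 else 0) * b i ≤ ε := by
  rcases le_total L m with h | h
  · simpa [Finset.Ico_eq_empty_of_le h] using hε
  suffices H : ∀ L, m ≤ L →
      ∑ i ∈ Finset.Ico m L, (if ∑ j ∈ Finset.Ico m (i + 1), b j ≤ ε then 1 else 0) * b i ≤
        min ε (∑ j ∈ Finset.Ico m L, b j) from (H L h).trans (min_le_left _ _)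
  intro L hL
  induction L, hL using Nat.le_induction with
  | base => simpa using hε
  | succ k hk ih =>
    rw [Finset.sum_Ico_succ_top hk, Finset.sum_Ico_succ_top hk]
    rw [le_min_iff] at ih
    split_ifs with h
    · exact le_min (by linarith) (by linarith)
    · exact le_min (by linarith) (by linarith [hb k])

/-- Comparison of the expectation of an adapted product `∏ Z i` with that of a product `∏ c i` whose
factors are known at time `m`, in terms of the distance of the `c i` to the conditional
expectations `q i` of the `Z i`. -/
theorem abs_integral_prod_sub_le [IsProbabilityMeasure μ] (F : Filtration ℕ mΩ)
    {Z q c : ℕ → Ω → ℝ} {m L : ℕ} (hmL : m ≤ L)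
    (hZ : ∀ i, Measurable[F (i + 1)] (Z i)) (hq : ∀ i, Measurable[F i] (q i))
    (hc : ∀ i, Measurable[F m] (c i))
    (hZ01 : ∀ i ω, Z i ω ∈ Set.Icc (0 : ℝ) 1) (hq01 : ∀ i ω, q i ω ∈ Set.Icc (0 : ℝ) 1)
    (hc01 : ∀ i ω, c i ω ∈ Set.Icc (0 : ℝ) 1)
    (hcond : ∀ i, m ≤ i → ∀ G : Ω → ℝ, Measurable[F i] G → (∀ ω, |G ω| ≤ 1) →
      ∫ ω, G ω * Z i ω ∂μ = ∫ ω, G ω * q i ω ∂μ) {ε : ℝ} (hε : 0 < ε) :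
    |∫ ω, ∏ i ∈ Finset.range L, Z i ω ∂μ -
      ∫ ω, (∏ i ∈ Finset.range m, Z i ω) * ∏ i ∈ Finset.Ico m L, c i ω ∂μ| ≤
    ε + ∫ ω, min 1 ((∑ i ∈ Finset.Ico m L, |q i ω - c i ω|) / ε) ∂μ := by
  have hZm : ∀ i, Measurable (Z i) := fun i => (hZ i).mono (F.le _) le_rfl
  have hqm : ∀ i, Measurable (q i) := fun i => (hq i).mono (F.le _) le_rfl
  have hcm : ∀ i, Measurable (c i) := fun i => (hc i).mono (F.le _) le_rfl
  -- `W k` interpolates between the two products (`k = L` and `k = m`). The error `S k` includes the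
  -- term of index `k` and is still known at time `k`, so the stopping indicator can be absorbed in
  -- the test variable `G k`.
  set W : ℕ → Ω → ℝ := fun k ω => (∏ i ∈ Finset.range k, Z i ω) * ∏ i ∈ Finset.Ico k L, c i ω
    with hW
  set S : ℕ → Ω → ℝ := fun k ω => ∑ j ∈ Finset.Ico m (k + 1), |q j ω - c j ω| with hS
  set G : ℕ → Ω → ℝ := fun k ω => (if S k ω ≤ ε then 1 else 0) *
    ((∏ i ∈ Finset.range k, Z i ω) * ∏ i ∈ Finset.Ico (k + 1) L, c i ω) with hG
  have hW01 : ∀ k ω, W k ω ∈ Set.Icc (0 : ℝ) 1 := fun k ω =>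
    ⟨mul_nonneg (Finset.prod_nonneg fun i _ => (hZ01 i ω).1)
      (Finset.prod_nonneg fun i _ => (hc01 i ω).1),
    mul_le_one₀ (Finset.prod_le_one (fun i _ => (hZ01 i ω).1) fun i _ => (hZ01 i ω).2)
      (Finset.prod_nonneg fun i _ => (hc01 i ω).1)
      (Finset.prod_le_one (fun i _ => (hc01 i ω).1) fun i _ => (hc01 i ω).2)⟩
  have hWm : ∀ k, Measurable (W k) := fun k =>
    (Finset.measurable_fun_prod _ fun i _ => hZm i).mul
      (Finset.measurable_fun_prod _ fun i _ => hcm i)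
  have hSmono : ∀ ω, Monotone fun k => S k ω := fun ω k l hkl =>
    Finset.sum_le_sum_of_subset_of_nonneg (Finset.Ico_subset_Ico_right (by omega))
      fun _ _ _ => abs_nonneg _
  have hSm : ∀ k, m ≤ k → Measurable[F k] (S k) := fun k hk =>
    Finset.measurable_fun_sum _ fun i hi => by
      have hi' : i ≤ k := by simp at hi; omega
      have h1 : Measurable[F k] (q i) := (hq i).mono (F.mono hi') le_rfl
      have h2 : Measurable[F k] (c i) := (hc i).mono (F.mono hk) le_rfl
      exact (show Measurable fun p : ℝ × ℝ => |p.1 - p.2| by fun_prop).comp (h1.prodMk h2)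
  have hGm : ∀ k, m ≤ k → Measurable[F k] (G k) := fun k hk => by
    refine Measurable.mul ?_ (Measurable.mul ?_ ?_)
    · exact (Measurable.ite measurableSet_Iic measurable_const measurable_const :
        Measurable fun s : ℝ => if s ≤ ε then (1 : ℝ) else 0).comp (hSm k hk)
    · refine Finset.measurable_fun_prod _ fun i hi => ?_
      have hi' : i + 1 ≤ k := by simp at hi; omega
      exact (hZ i).mono (F.mono hi') le_rfl
    · exact Finset.measurable_fun_prod _ fun i _ => (hc i).mono (F.mono hk) le_rfl
  have hG01 : ∀ k ω, 0 ≤ G k ω ∧ G k ω ≤ if S k ω ≤ ε then 1 else 0 := fun k ω => by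
    have h1 : 0 ≤ (∏ i ∈ Finset.range k, Z i ω) * ∏ i ∈ Finset.Ico (k + 1) L, c i ω :=
      mul_nonneg (Finset.prod_nonneg fun i _ => (hZ01 i ω).1)
        (Finset.prod_nonneg fun i _ => (hc01 i ω).1)
    have h2 : (∏ i ∈ Finset.range k, Z i ω) * ∏ i ∈ Finset.Ico (k + 1) L, c i ω ≤ 1 :=
      mul_le_one₀ (Finset.prod_le_one (fun i _ => (hZ01 i ω).1) fun i _ => (hZ01 i ω).2)
        (Finset.prod_nonneg fun i _ => (hc01 i ω).1)
        (Finset.prod_le_one (fun i _ => (hc01 i ω).1) fun i _ => (hc01 i ω).2)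
    simp only [hG]
    split_ifs <;> simp [h1, h2]
  have hGabs : ∀ k ω, |G k ω| ≤ 1 := fun k ω => by
    rw [abs_of_nonneg (hG01 k ω).1]
    exact (hG01 k ω).2.trans (by split_ifs <;> norm_num)
  have hWsub : ∀ k ω, k < L → (if S k ω ≤ ε then 1 else 0) * (W (k + 1) ω - W k ω) =
      G k ω * Z k ω - G k ω * c k ω := fun k ω hk => by
    simp only [hW, hG]
    rw [Finset.prod_range_succ, Finset.prod_eq_prod_Ico_succ_bot hk]
    ring
  have hbd : ∀ g : Ω → ℝ, Measurable g → (∀ ω, |g ω| ≤ 1) → Integrable g μ := fun g hg hg1 =>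
    Integrable.of_bound hg.aestronglyMeasurable 1 (Eventually.of_forall hg1)
  have hGi : ∀ k, m ≤ k → ∀ g : Ω → ℝ, Measurable g → (∀ ω, g ω ∈ Set.Icc (0 : ℝ) 1) →
      Integrable (fun ω => G k ω * g ω) μ := fun k hk g hg hg1 => by
    refine hbd _ (((hGm k hk).mono (F.le _) le_rfl).mul hg) fun ω => ?_
    rw [abs_mul, abs_of_nonneg (hg1 ω).1]
    exact mul_le_one₀ (hGabs k ω) (hg1 ω).1 (hg1 ω).2
  have hmain : ∀ k ∈ Finset.Ico m L,
      ∫ ω, (if S k ω ≤ ε then 1 else 0) * (W (k + 1) ω - W k ω) ∂μ =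
        ∫ ω, G k ω * (q k ω - c k ω) ∂μ := fun k hk => by
    obtain ⟨hk1, hk2⟩ := Finset.mem_Ico.1 hk
    simp_rw [mul_sub (G k _), hWsub k _ hk2]
    rw [integral_sub (hGi k hk1 _ (hZm k) (hZ01 k)) (hGi k hk1 _ (hcm k) (hc01 k)),
      integral_sub (hGi k hk1 _ (hqm k) (hq01 k)) (hGi k hk1 _ (hcm k) (hc01 k)),
      hcond k hk1 _ (hGm k hk1) (hGabs k)]
  have hWS : ∀ k ∈ Finset.Ico m L,
      Integrable (fun ω => (if S k ω ≤ ε then 1 else 0) * (W (k + 1) ω - W k ω)) μ := fun k hk => by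
    obtain ⟨hk1, hk2⟩ := Finset.mem_Ico.1 hk
    simp_rw [hWsub k _ hk2]
    exact (hGi k hk1 _ (hZm k) (hZ01 k)).sub (hGi k hk1 _ (hcm k) (hc01 k))
  have hWi : ∀ k, Integrable (W k) μ := fun k => hbd _ (hWm k) fun ω => by
    rw [abs_of_nonneg (hW01 k ω).1]; exact (hW01 k ω).2
  set V : Ω → ℝ := fun ω =>
    ∑ k ∈ Finset.Ico m L, (if S k ω ≤ ε then 1 else 0) * (W (k + 1) ω - W k ω) with hV
  have hVi : Integrable V μ := integrable_finsetSum _ hWS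
  -- In each stopped increment the conditional mean `q k` may replace `Z k`; what remains is the
  -- stopped sum of `|q k - c k|`.
  have hVint : |∫ ω, V ω ∂μ| ≤ ε := by
    rw [hV, integral_finsetSum _ hWS, Finset.sum_congr rfl hmain, ← integral_finsetSum]
    · refine (abs_integral_le_integral_abs).trans ?_
      refine (integral_mono_of_nonneg (Eventually.of_forall fun _ => abs_nonneg _)
        (integrable_const ε) (Eventually.of_forall fun ω => ?_)).trans (by simp)
      refine (Finset.abs_sum_le_sum_abs _ _).trans
        (le_trans (Finset.sum_le_sum fun k _ => ?_)
          (sum_ite_mul_le (m := m) (L := L) hε.le fun i => abs_nonneg (q i ω - c i ω)))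
      rw [abs_mul, abs_of_nonneg (hG01 k ω).1]
      exact mul_le_mul_of_nonneg_right (hG01 k ω).2 (abs_nonneg _)
    · intro k hk
      simp_rw [mul_sub]
      exact (hGi k (Finset.mem_Ico.1 hk).1 _ (hqm k) (hq01 k)).sub
        (hGi k (Finset.mem_Ico.1 hk).1 _ (hcm k) (hc01 k))
  have hminm : Measurable fun ω => min 1 ((∑ i ∈ Finset.Ico m L, |q i ω - c i ω|) / ε) :=
    measurable_const.min ((Finset.measurable_fun_sum _ fun i _ =>
      ((hqm i).sub (hcm i)).abs).div_const ε)
  have hmin0 : ∀ ω, 0 ≤ (∑ i ∈ Finset.Ico m L, |q i ω - c i ω|) / ε := fun ω =>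
    div_nonneg (Finset.sum_nonneg fun _ _ => abs_nonneg _) hε.le
  have hmini := hbd _ hminm fun ω => by
    rw [abs_of_nonneg (le_min zero_le_one (hmin0 ω))]; exact min_le_left _ _
  -- Stopping changes nothing unless the total error exceeds `ε`; on that event the discrepancy is
  -- at most `1`.
  have hpt : ∀ ω, |W L ω - W m ω - V ω| ≤
      min 1 ((∑ i ∈ Finset.Ico m L, |q i ω - c i ω|) / ε) := fun ω => by
    obtain ⟨j, -, hsum, hj⟩ := exists_sum_mul_sub_eq (m := m) (L := L) (ε := ε)
      (W := fun k => W k ω) (hSmono ω) L hmL le_rfl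
    have hVω : V ω = W j ω - W m ω := hsum
    rw [hVω]
    by_cases h : ∑ i ∈ Finset.Ico m L, |q i ω - c i ω| ≤ ε
    · rw [hj fun i _ hi => le_trans (Finset.sum_le_sum_of_subset_of_nonneg
        (Finset.Ico_subset_Ico_right hi) fun _ _ _ => abs_nonneg _) h]
      simpa using hmin0 ω
    · rw [min_eq_left ((one_le_div hε).2 (not_le.1 h).le), abs_le]
      have h1 := hW01 L ω
      have h2 := hW01 j ω
      constructor <;> linarith [h1.1, h1.2, h2.1, h2.2]
  have hWL : (∫ ω, ∏ i ∈ Finset.range L, Z i ω ∂μ) = ∫ ω, W L ω ∂μ := by simp [hW]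
  rw [hWL]
  have hsplit : ∫ ω, W L ω ∂μ - ∫ ω, W m ω ∂μ =
      ∫ ω, V ω ∂μ + ∫ ω, (W L ω - W m ω - V ω) ∂μ := by
    have h1 := integral_sub ((hWi L).sub (hWi m)) hVi
    simp only [Pi.sub_apply] at h1
    rw [h1, integral_sub (hWi L) (hWi m)]
    ring
  change |∫ ω, W L ω ∂μ - ∫ ω, W m ω ∂μ| ≤ _
  rw [hsplit]
  refine (abs_add_le _ _).trans (add_le_add hVint ?_)
  refine abs_integral_le_integral_abs.trans (integral_mono_of_nonneg
    (Eventually.of_forall fun _ => abs_nonneg _) hmini (Eventually.of_forall hpt))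

end Comparison

/-! ### The standard exponential law: density and moments -/

section Exponential

theorem expMeasure_one_eq :
    expMeasure 1 =
      (volume.restrict (Set.Ioi 0)).withDensity fun u => ENNReal.ofReal (Real.exp (-u)) := by
  rw [expMeasure, gammaMeasure, ← withDensity_indicator measurableSet_Ioi]
  refine withDensity_congr_ae ?_
  filter_upwards [(Set.countable_singleton (0 : ℝ)).ae_notMem volume] with u hu
  have hu' : u ≠ 0 := hu
  change exponentialPDF 1 u = _
  rw [exponentialPDF_eq]
  rcases lt_or_gt_of_ne hu' with h | h
  · rw [if_neg (not_le.2 h), Set.indicator_of_notMem (by simpa using h.le)]; simp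
  · rw [if_pos h.le, Set.indicator_of_mem (by simpa using h)]; simp

theorem integral_expMeasure_one (g : ℝ → ℝ) :
    ∫ u, g u ∂(expMeasure 1) = ∫ u in Set.Ioi 0, Real.exp (-u) * g u := by
  rw [expMeasure_one_eq, integral_withDensity_eq_integral_toReal_smul (by fun_prop) (by simp)]
  simp [ENNReal.toReal_ofReal (Real.exp_pos _).le]

theorem integrable_expMeasure_one_iff (g : ℝ → ℝ) :
    Integrable g (expMeasure 1) ↔ IntegrableOn (fun u => Real.exp (-u) * g u) (Set.Ioi 0) := by
  rw [expMeasure_one_eq, integrable_withDensity_iff_integrable_smul' (by fun_prop) (by simp)]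
  simp [ENNReal.toReal_ofReal (Real.exp_pos _).le, IntegrableOn]

theorem ae_expMeasure_one_pos : ∀ᵐ u ∂(expMeasure 1), 0 < u := by
  rw [expMeasure_one_eq]
  exact (withDensity_absolutelyContinuous _ _).ae_le (ae_restrict_mem measurableSet_Ioi)

theorem memLp_id_expMeasure_one : MemLp id 2 (expMeasure 1) := by
  rw [memLp_two_iff_integrable_sq measurable_id.aestronglyMeasurable,
    integrable_expMeasure_one_iff]
  have := Real.GammaIntegral_convergent (s := 3) (by norm_num)
  refine this.congr_fun (fun u _ => ?_) measurableSet_Ioi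
  simp only [id]
  norm_num

theorem integral_id_expMeasure_one : ∫ u, u ∂(expMeasure 1) = 1 := by
  rw [integral_expMeasure_one]
  have := Real.Gamma_eq_integral (s := 2) (by norm_num)
  rw [Real.Gamma_two] at this
  rw [this]
  refine setIntegral_congr_fun measurableSet_Ioi fun u _ => ?_
  norm_num

end Exponential

/-! ### The filtration of the exponential variables -/

section Past

variable {Ω : Type*} {mΩ : MeasurableSpace Ω} {μ : Measure Ω}

/-- The filtration whose `n`-th σ-algebra is generated by `E 0, …, E (n - 1)`. -/
def past (E : ℕ → Ω → ℝ) (hE : ∀ i, Measurable (E i)) : Filtration ℕ mΩ where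
  seq n := ⨆ k ∈ Set.Iio n, MeasurableSpace.comap (E k) inferInstance
  mono' _ _ h := biSup_mono fun _ hk => lt_of_lt_of_le hk h
  le' _ := iSup₂_le fun k _ => (hE k).comap_le

variable {E : ℕ → Ω → ℝ} (hE : ∀ i, Measurable (E i))

theorem measurable_past {k n : ℕ} (h : k < n) : Measurable[past E hE n] (E k) := by
  rw [measurable_iff_comap_le]
  exact le_iSup₂_of_le (f := fun k (_ : k ∈ Set.Iio n) =>
    MeasurableSpace.comap (E k) inferInstance) k h le_rfl

theorem measurable_splitTime_past (n : ℕ) : Measurable[past E hE n] (splitTime E n) :=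
  Finset.measurable_fun_sum _ fun i hi =>
    (measurable_id.div_const _).comp (measurable_past hE (Finset.mem_range.1 hi))

theorem indep_past (hindep : iIndepFun E μ) (n : ℕ) :
    Indep (past E hE n) (MeasurableSpace.comap (E n) inferInstance) μ := by
  suffices H : Indep (⨆ k ∈ Set.Iio n, MeasurableSpace.comap (E k) inferInstance)
      (⨆ k ∈ ({n} : Set ℕ), MeasurableSpace.comap (E k) inferInstance) μ by
    rwa [iSup_singleton] at H
  exact indep_iSup_of_disjoint (fun k => (hE k).comap_le) hindep (by simp)

end Past

/-! ### Almost sure convergence of the centred split times -/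

section Convergence

variable {Ω : Type*} {mΩ : MeasurableSpace Ω} {μ : Measure Ω} [IsProbabilityMeasure μ]
  {E : ℕ → Ω → ℝ}

/-- The partial sums form a martingale bounded in `L²` by orthogonality, hence in `L¹` through `|x|
≤ 1 + x²`, and martingale convergence applies. -/
theorem exists_ae_tendsto_sum_of_iIndepFun {X : ℕ → Ω → ℝ} (hX : ∀ i, Measurable (X i))
    (hindep : iIndepFun X μ) (hX2 : ∀ i, MemLp (X i) 2 μ) (hX0 : ∀ i, ∫ ω, X i ω ∂μ = 0)
    (hvar : Summable fun i => variance (X i) μ) :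
    ∀ᵐ ω ∂μ, ∃ c, Tendsto (fun n => ∑ i ∈ Finset.range n, X i ω) atTop (𝓝 c) := by
  have hXi : ∀ i, Integrable (X i) μ := fun i => (hX2 i).integrable (by norm_num)
  set M : ℕ → Ω → ℝ := fun n => ∑ i ∈ Finset.range n, X i with hM
  have hMi : ∀ n, Integrable (M n) μ := fun n => integrable_finsetSum' _ fun i _ => hXi i
  have hM2 : ∀ n, MemLp (M n) 2 μ := fun n => memLp_finsetSum' _ fun i _ => hX2 i
  have hM0 : ∀ n, ∫ ω, M n ω ∂μ = 0 := fun n => by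
    simp only [hM, Finset.sum_apply]
    rw [integral_finsetSum _ fun i _ => hXi i]
    simp [hX0]
  have hmart : Martingale M (past X hX) μ := by
    refine martingale_of_condExp_sub_eq_zero_nat (fun n => ?_) hMi fun n => ?_
    · have : Measurable[past X hX n] fun ω => ∑ i ∈ Finset.range n, X i ω :=
        Finset.measurable_fun_sum _ fun i hi => measurable_past hX (Finset.mem_range.1 hi)
      have h2 := this.stronglyMeasurable
      convert h2 using 1
      ext ω
      simp [hM]
    · have h1 : M (n + 1) - M n = X n := by simp [hM, Finset.sum_range_succ]
      rw [h1]
      refine (condExp_indep_eq (hX n).comap_le ((past X hX).le n)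
        (comap_measurable _).stronglyMeasurable (indep_past hX hindep n).symm).trans ?_
      simp [hX0]
      rfl
  refine (hmart.submartingale.exists_ae_tendsto_of_bdd
    (R := (1 + ∑' i, variance (X i) μ).toNNReal) fun n => ?_).mono fun ω h => by
      simpa [hM] using h
  rw [eLpNorm_one_eq_lintegral_enorm, ← ofReal_integral_norm_eq_lintegral_enorm (hMi n)]
  refine ENNReal.ofReal_le_ofReal ?_
  have hsq : ∫ ω, M n ω ^ 2 ∂μ = ∑ i ∈ Finset.range n, variance (X i) μ := by
    rw [← variance_of_integral_eq_zero (hM2 n).aemeasurable (hM0 n), hM,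
      IndepFun.variance_sum (fun i _ => hX2 i)]
    exact fun i _ j _ hij => hindep.indepFun hij
  calc ∫ ω, ‖M n ω‖ ∂μ ≤ ∫ ω, (1 + M n ω ^ 2) ∂μ := by
        refine integral_mono (hMi n).norm ((integrable_const 1).add (hM2 n).integrable_sq)
          fun ω => ?_
        simp only [Real.norm_eq_abs]
        nlinarith [sq_abs (M n ω), abs_nonneg (M n ω), sq_nonneg (|M n ω| - 1)]
    _ = 1 + ∑ i ∈ Finset.range n, variance (X i) μ := by
        rw [integral_add (integrable_const 1) (hM2 n).integrable_sq, hsq]; simp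
    _ ≤ 1 + ∑' i, variance (X i) μ := by
        gcongr
        exact hvar.sum_le_tsum _ fun i _ => variance_nonneg _ _

/-- `M_n` is the sum of the independent centred variables `(E_i - 1)/i`, with summable variances,
plus the harmonic number minus `log n`, which tends to Euler's constant. -/
theorem ae_tendsto_martingaleM (hE : ∀ i, Measurable (E i))
    (hlaw : ∀ i, HasLaw (E i) (expMeasure 1) μ) (hindep : iIndepFun E μ) :
    ∀ᵐ ω ∂μ, Tendsto (fun n : ℕ => martingaleM E n ω) atTop (𝓝 (limitM E ω)) := by
  have : IsProbabilityMeasure (expMeasure 1) := isProbabilityMeasure_expMeasure one_pos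
  have hE2 : ∀ i, MemLp (E i) 2 μ := fun i => by
    have := memLp_id_expMeasure_one
    rw [← (hlaw i).map_eq, memLp_map_measure_iff measurable_id.aestronglyMeasurable
      (hlaw i).aemeasurable] at this
    exact this
  have hE1 : ∀ i, ∫ ω, E i ω ∂μ = 1 := fun i => by
    rw [(hlaw i).integral_eq, integral_id_expMeasure_one]
  have key := exists_ae_tendsto_sum_of_iIndepFun (μ := μ)
    (X := fun i ω => ((i : ℝ) + 1)⁻¹ * (E i ω - 1))
    (fun i => ((hE i).sub_const 1).const_mul _)
    (hindep.comp (fun i x => ((i : ℝ) + 1)⁻¹ * (x - 1)) fun i => by fun_prop)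
    (fun i => ((hE2 i).sub (memLp_const 1)).const_mul _)
    (fun i => by
      rw [integral_const_mul, integral_sub ((hE2 i).integrable (by norm_num))
        (integrable_const 1), hE1]
      simp)
    (by
      have hv : ∀ i : ℕ, variance (fun ω => ((i : ℝ) + 1)⁻¹ * (E i ω - 1)) μ =
          (((i : ℝ) + 1)⁻¹) ^ 2 * variance id (expMeasure 1) := fun i => by
        rw [variance_const_mul, variance_sub_const (hE2 i).aestronglyMeasurable,
          (hlaw i).variance_eq]
      simp_rw [hv]
      refine Summable.mul_right _ ?_
      have := (summable_nat_add_iff 1).2 (Real.summable_nat_pow_inv.2 (one_lt_two))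
      refine this.congr fun i => ?_
      push_cast
      rw [inv_pow])
  filter_upwards [key] with ω ⟨c, hc⟩
  refine tendsto_nhds_limUnder ⟨c + Real.eulerMascheroniConstant, ?_⟩
  refine (hc.add Real.tendsto_harmonic_sub_log).congr fun n => ?_
  simp only [martingaleM, splitTime, harmonic]
  push_cast
  rw [← add_sub_assoc, ← Finset.sum_add_distrib]
  congr 1
  refine Finset.sum_congr rfl fun i _ => ?_
  field_simp
  ring

end Convergence

/-! ### The law of a rescaled bin mass and its linearization -/

section ChangeOfVariables

/-- Substitute `u = -p log (1 - v/l)`: then `exp (-u) = (1 - v/l)^p` and `du = (p/l) (1 - v/l)⁻¹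
dv`. -/
theorem integral_comp_one_sub_exp {l p : ℝ} (hl : 0 < l) (hp : 0 < p) (g : ℝ → ℝ) :
    ∫ u, g (l * (1 - Real.exp (-(u / p)))) ∂(expMeasure 1) =
      ∫ v in Set.Ioo 0 l, p / l * ((1 - v / l) ^ (p - 1) * g v) := by
  have hpos : ∀ v ∈ Set.Ioo 0 l, 0 < 1 - v / l := fun v hv => by
    rw [sub_pos, div_lt_one hl]; exact hv.2
  have hderiv : ∀ v ∈ Set.Ioo 0 l, HasDerivWithinAt (fun v => -p * Real.log (1 - v / l))
      (p / l * (1 - v / l)⁻¹) (Set.Ioo 0 l) v := fun v hv => by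
    have h1 : HasDerivAt (fun v : ℝ => 1 - v / l) (-(1 / l)) v := by
      simpa using ((hasDerivAt_id v).div_const l).const_sub 1
    have h2 := (h1.log (hpos v hv).ne').const_mul (-p)
    have h3 : p / l * (1 - v / l)⁻¹ = -p * (-(1 / l) / (1 - v / l)) := by ring
    rw [h3]
    exact h2.hasDerivWithinAt
  have hinv : ∀ v ∈ Set.Ioo 0 l, l * (1 - Real.exp (-(-p * Real.log (1 - v / l) / p))) = v :=
    fun v hv => by
      have : -(-p * Real.log (1 - v / l) / p) = Real.log (1 - v / l) := by field_simp
      rw [this, Real.exp_log (hpos v hv)]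
      field_simp
      ring
  have himage : (fun v => -p * Real.log (1 - v / l)) '' Set.Ioo 0 l = Set.Ioi 0 := by
    ext u
    constructor
    · rintro ⟨v, hv, rfl⟩
      have h1 : Real.log (1 - v / l) < 0 := Real.log_neg (hpos v hv) (by
        have := div_pos hv.1 hl
        linarith)
      simp only [Set.mem_Ioi]
      nlinarith
    · intro hu
      have hu' : 0 < u / p := div_pos hu hp
      have h1 : Real.exp (-(u / p)) < 1 := Real.exp_lt_one_iff.2 (by linarith)
      refine ⟨l * (1 - Real.exp (-(u / p))), ⟨by nlinarith, by nlinarith [Real.exp_pos (-(u / p))]⟩, ?_⟩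
      have : 1 - l * (1 - Real.exp (-(u / p))) / l = Real.exp (-(u / p)) := by
        field_simp
        ring
      simp only [this, Real.log_exp]
      field_simp
  have hinj : Set.InjOn (fun v => -p * Real.log (1 - v / l)) (Set.Ioo 0 l) := fun v hv w hw h => by
    have h' : -p * Real.log (1 - v / l) = -p * Real.log (1 - w / l) := h
    rw [← hinv v hv, ← hinv w hw, h']
  rw [integral_expMeasure_one, ← himage,
    integral_image_eq_integral_abs_deriv_smul measurableSet_Ioo hderiv hinj]
  refine setIntegral_congr_fun measurableSet_Ioo fun v hv => ?_
  have h0 := hpos v hv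
  simp only [smul_eq_mul]
  rw [hinv v hv, abs_of_pos (by positivity), Real.rpow_sub_one h0.ne',
    Real.rpow_def_of_pos h0]
  have : -(-p * Real.log (1 - v / l)) = Real.log (1 - v / l) * p := by ring
  rw [this]
  field_simp

/-- The error term `∫ H(v) min(1, δ v) dv`. -/
def linearizationError (H : ℝ → ℝ) (δ : ℝ) : ℝ := ∫ v in Set.Ioi 0, H v * min 1 (δ * v)

variable {H : ℝ → ℝ}

theorem integrableOn_mul_min (hH : IntegrableOn H (Set.Ioi 0)) {δ : ℝ} (hδ : 0 ≤ δ) :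
    IntegrableOn (fun v => H v * min 1 (δ * v)) (Set.Ioi 0) := by
  refine Integrable.mul_bdd (c := 1) hH (by fun_prop) ?_
  filter_upwards [ae_restrict_mem measurableSet_Ioi] with v hv
  have hv' : (0 : ℝ) < v := hv
  rw [Real.norm_of_nonneg (le_min zero_le_one (by positivity))]
  exact min_le_left _ _

theorem linearizationError_nonneg (hH0 : ∀ v, 0 < v → 0 ≤ H v) {δ : ℝ} (hδ : 0 ≤ δ) :
    0 ≤ linearizationError H δ :=
  setIntegral_nonneg measurableSet_Ioi fun v hv =>
    mul_nonneg (hH0 v hv) (le_min zero_le_one (mul_nonneg hδ (le_of_lt hv)))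

theorem linearizationError_mono (hH : IntegrableOn H (Set.Ioi 0)) (hH0 : ∀ v, 0 < v → 0 ≤ H v)
    {δ δ' : ℝ} (hδ : 0 ≤ δ) (h : δ ≤ δ') : linearizationError H δ ≤ linearizationError H δ' := by
  refine setIntegral_mono_on (integrableOn_mul_min hH hδ) (integrableOn_mul_min hH (hδ.trans h))
    measurableSet_Ioi fun v hv => ?_
  exact mul_le_mul_of_nonneg_left
    (min_le_min le_rfl (mul_le_mul_of_nonneg_right h (le_of_lt hv))) (hH0 v hv)

theorem tendsto_linearizationError (hH : IntegrableOn H (Set.Ioi 0)) {δ : ℕ → ℝ}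
    (hδ0 : ∀ n, 0 ≤ δ n) (hδ : Tendsto δ atTop (𝓝 0)) :
    Tendsto (fun n => linearizationError H (δ n)) atTop (𝓝 0) := by
  have : Tendsto (fun n => linearizationError H (δ n)) atTop
      (𝓝 (∫ v in Set.Ioi 0, H v * min 1 (0 * v))) := by
    refine tendsto_integral_of_dominated_convergence (fun v => ‖H v‖)
      (fun n => (integrableOn_mul_min hH (hδ0 n)).aestronglyMeasurable) hH.norm (fun n => ?_) ?_
    · filter_upwards [ae_restrict_mem measurableSet_Ioi] with v hv
      have hv' : (0 : ℝ) < v := hv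
      have := hδ0 n
      rw [norm_mul, Real.norm_of_nonneg (le_min zero_le_one (by positivity))]
      exact mul_le_of_le_one_right (norm_nonneg _) (min_le_left _ _)
    · refine Eventually.of_forall fun v => ?_
      exact (tendsto_const_nhds.min (hδ.mul_const v)).const_mul _
  simpa using this

/-- Below `l`, lowering the exponent from `p` to `p - 1` increases the power, and Bernoulli's
inequality bounds the `p`-th power below by `1 - p v/l`. Beyond `l` the bound `p v/l` is at least
`1`. The assumption `1 ≤ p` keeps the weight at most `1`. -/
theorem one_sub_ite_rpow_le {l p v : ℝ} (hl : 0 < l) (hp : 1 ≤ p) (hv : 0 < v) :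
    0 ≤ 1 - (if v < l then (1 - v / l) ^ (p - 1) else 0) ∧
      1 - (if v < l then (1 - v / l) ^ (p - 1) else 0) ≤ min 1 (p / l * v) := by
  have hvl : 0 < v / l := div_pos hv hl
  have hpl : p / l * v = p * (v / l) := by ring
  split_ifs with h
  · have h1 : 0 < 1 - v / l := by rw [sub_pos, div_lt_one hl]; exact h
    have h2 : (1 - v / l) ^ (p - 1) ≤ 1 := Real.rpow_le_one h1.le (by linarith) (by linarith)
    have h3 : (1 - v / l) ^ p ≤ (1 - v / l) ^ (p - 1) :=
      Real.rpow_le_rpow_of_exponent_ge h1 (by linarith) (by linarith)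
    have h4 := one_add_mul_self_le_rpow_one_add (s := -(v / l)) (by linarith) hp
    rw [← sub_eq_add_neg] at h4
    refine ⟨by linarith, le_min (by linarith [Real.rpow_nonneg h1.le (p - 1)]) ?_⟩
    rw [hpl]
    linarith
  · have h1 : 1 ≤ v / l := by rw [one_le_div hl]; exact not_lt.1 h
    refine ⟨by norm_num, le_min (by norm_num) ?_⟩
    rw [hpl]
    nlinarith

/-- The exact density is `p/l` times a weight `w` with `0 ≤ 1 - w ≤ min 1 (p v/l)`; integrating this
defect against the envelope `H` gives the error. -/
theorem abs_integral_comp_one_sub_exp_sub_le {g : ℝ → ℝ} (hg : Measurable g)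
    (hH : IntegrableOn H (Set.Ioi 0)) (hg0 : ∀ v, 0 < v → 0 ≤ g v)
    (hgH : ∀ v, 0 < v → g v ≤ H v) {l p : ℝ} (hl : 0 < l) (hp : 1 ≤ p) :
    |∫ u, g (l * (1 - Real.exp (-(u / p)))) ∂(expMeasure 1) - p / l * ∫ v in Set.Ioi 0, g v| ≤
      p / l * linearizationError H (p / l) := by
  have hp0 : 0 < p := by linarith
  have hpl : 0 < p / l := div_pos hp0 hl
  set w : ℝ → ℝ := fun v => if v < l then (1 - v / l) ^ (p - 1) else 0 with hw
  have hwm : Measurable w := Measurable.ite measurableSet_Iio (by fun_prop) measurable_const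
  have hgi : IntegrableOn g (Set.Ioi 0) := by
    refine Integrable.mono' hH hg.aestronglyMeasurable ?_
    filter_upwards [ae_restrict_mem measurableSet_Ioi] with v hv
    rw [Real.norm_of_nonneg (hg0 v hv)]
    exact hgH v hv
  have hw1 : ∀ v, 0 < v → 0 ≤ 1 - w v ∧ 1 - w v ≤ min 1 (p / l * v) := fun v hv =>
    one_sub_ite_rpow_le hl hp hv
  have hwgi : IntegrableOn (fun v => w v * g v) (Set.Ioi 0) := by
    refine Integrable.bdd_mul (c := 1) hgi hwm.aestronglyMeasurable ?_
    filter_upwards [ae_restrict_mem measurableSet_Ioi] with v hv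
    have h1 := hw1 v hv
    rw [Real.norm_eq_abs, abs_le]
    constructor <;> linarith [h1.1, h1.2, min_le_left 1 (p / l * v)]
  have h1 : ∫ u, g (l * (1 - Real.exp (-(u / p)))) ∂(expMeasure 1) =
      p / l * ∫ v in Set.Ioi 0, w v * g v := by
    rw [integral_comp_one_sub_exp hl hp0, integral_const_mul]
    congr 1
    have h2 : ∫ v in Set.Ioi 0, w v * g v = ∫ v in Set.Ioo 0 l, w v * g v :=
      setIntegral_eq_of_subset_of_forall_sdiff_eq_zero measurableSet_Ioi
        Set.Ioo_subset_Ioi_self fun v hv => by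
          have : ¬ v < l := fun h => hv.2 ⟨hv.1, h⟩
          simp [hw, this]
    rw [h2]
    refine setIntegral_congr_fun measurableSet_Ioo fun v hv => ?_
    simp only [hw, if_pos hv.2]
  rw [h1, ← mul_sub, abs_mul, abs_of_pos hpl, ← integral_sub hwgi hgi]
  refine mul_le_mul_of_nonneg_left ?_ hpl.le
  rw [← Real.norm_eq_abs, linearizationError]
  refine norm_integral_le_of_norm_le (integrableOn_mul_min hH hpl.le) ?_
  filter_upwards [ae_restrict_mem measurableSet_Ioi] with v hv
  have h2 := hw1 v hv
  have h3 : w v * g v - g v = -(g v * (1 - w v)) := by ring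
  rw [h3, norm_neg, Real.norm_of_nonneg (mul_nonneg (hg0 v hv) h2.1)]
  exact mul_le_mul (hgH v hv) h2.2 h2.1 ((hg0 v hv).trans (hgH v hv))

end ChangeOfVariables

/-! ### Riemann sums with a real mesh -/

section RiemannSum

theorem tendsto_riemannSum {g : ℝ → ℝ} (hg : Continuous g) {K : ℝ} (hK : 0 ≤ K)
    (hgK : ∀ x, K ≤ x → g x = 0) {N : ℕ → ℝ} (hN : Tendsto N atTop atTop) :
    Tendsto (fun n => ∑ i ∈ Finset.range ⌈K * N n⌉₊, (N n)⁻¹ * g (((i : ℝ) + 1) / N n)) atTop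
      (𝓝 (∫ x in Set.Ioi 0, g x)) := by
  rw [Metric.tendsto_nhds]
  intro ε hε
  -- The last cell may reach past `K`, by at most `1` once `N n ≥ 1`. There are at most `(K + 1) N
  -- n` cells, so a local error of `ε / (2 (K + 1))` adds up to at most `ε / 2`.
  have huc := (isCompact_Icc (a := (0 : ℝ)) (b := K + 1)).uniformContinuousOn_of_continuous
    hg.continuousOn
  rw [Metric.uniformContinuousOn_iff] at huc
  obtain ⟨δ, hδ, hδg⟩ := huc (ε / (2 * (K + 1))) (by positivity)
  filter_upwards [hN.eventually_ge_atTop 1, hN.eventually_gt_atTop δ⁻¹] with n hn1 hnδ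
  set T := N n with hT
  have hT0 : 0 < T := by linarith
  have hTδ : T⁻¹ < δ := inv_lt_of_inv_lt₀ hδ hnδ
  set L := ⌈K * T⌉₊ with hL
  have hL1 : K * T ≤ L := Nat.le_ceil _
  have hL2 : (L : ℝ) < K * T + 1 := Nat.ceil_lt_add_one (by positivity)
  have hint : ∫ x in Set.Ioi 0, g x =
      ∑ i ∈ Finset.range L, ∫ x in ((i : ℝ) / T)..(((i : ℝ) + 1) / T), g x := by
    have := intervalIntegral.sum_integral_adjacent_intervals (f := g) (μ := volume)
      (a := fun i : ℕ => (i : ℝ) / T) (n := L) fun k _ => hg.intervalIntegrable _ _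
    push_cast at this
    rw [this, zero_div, intervalIntegral.integral_of_le (by positivity)]
    refine setIntegral_eq_of_subset_of_forall_sdiff_eq_zero measurableSet_Ioi
      Set.Ioc_subset_Ioi_self ?_
    rintro x ⟨hx, hx'⟩
    refine hgK x ?_
    by_contra hlt
    exact hx' ⟨hx, (not_le.1 hlt).le.trans ((le_div_iff₀ hT0).2 hL1)⟩
  rw [hint, dist_eq_norm, ← Finset.sum_sub_distrib]
  have hterm : ∀ i ∈ Finset.range L, ‖T⁻¹ * g (((i : ℝ) + 1) / T) -
      ∫ x in ((i : ℝ) / T)..(((i : ℝ) + 1) / T), g x‖ ≤ ε / (2 * (K + 1)) * T⁻¹ := fun i hi => by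
    have hlen : ((i : ℝ) + 1) / T - (i : ℝ) / T = T⁻¹ := by field_simp; ring
    have hle : (i : ℝ) / T ≤ ((i : ℝ) + 1) / T := by gcongr; linarith
    have h1 : T⁻¹ * g (((i : ℝ) + 1) / T) =
        ∫ x in ((i : ℝ) / T)..(((i : ℝ) + 1) / T), g (((i : ℝ) + 1) / T) := by
      rw [intervalIntegral.integral_const, hlen, smul_eq_mul]
    rw [h1, ← intervalIntegral.integral_sub (by simp) (hg.intervalIntegrable _ _)]
    refine (intervalIntegral.norm_integral_le_of_norm_le_const (C := ε / (2 * (K + 1)))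
      fun x hx => ?_).trans_eq ?_
    · rw [Set.uIoc_of_le hle] at hx
      have hi' : (i : ℝ) + 1 ≤ L := by exact_mod_cast Finset.mem_range.1 hi
      have hup : ((i : ℝ) + 1) / T ≤ K + 1 := by
        rw [div_le_iff₀ hT0]; nlinarith
      have hx0 : 0 ≤ x := le_trans (by positivity) hx.1.le
      rw [← dist_eq_norm]
      refine (hδg _ ⟨by positivity, hup⟩ _ ⟨hx0, hx.2.trans hup⟩ ?_).le
      rw [Real.dist_eq, abs_of_nonneg (by linarith [hx.2])]
      linarith [hx.1]
    · rw [hlen, abs_of_pos (by positivity)]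
  refine (norm_sum_le_of_le _ hterm).trans_lt ?_
  rw [Finset.sum_const, Finset.card_range, nsmul_eq_mul]
  have h2 : (L : ℝ) * T⁻¹ ≤ K + 1 := by
    rw [← div_eq_mul_inv, div_le_iff₀ hT0]; nlinarith
  calc (L : ℝ) * (ε / (2 * (K + 1)) * T⁻¹) = ε / (2 * (K + 1)) * (L * T⁻¹) := by ring
    _ ≤ ε / (2 * (K + 1)) * (K + 1) := by gcongr
    _ = ε / 2 := by field_simp
    _ < ε := by linarith

end RiemannSum

/-! ### Conditional factors and their approximate compensators -/

section

/-- `h` takes values in `[0, 1]`, vanishes for `x ≥ K`, and is dominated, uniformly in `x`, by an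
integrable function of `y` that tends to `0`. -/
structure IsDominated (h : ℝ → ℝ → ℝ) (H : ℝ → ℝ) (K : ℝ) : Prop where
  continuous : Continuous (Function.uncurry h)
  nonneg : ∀ x v, 0 ≤ h x v
  le_one : ∀ x v, h x v ≤ 1
  le_bound : ∀ x v, 0 < v → h x v ≤ H v
  integrable : IntegrableOn H (Set.Ioi 0)
  tendsto_bound : Tendsto H atTop (𝓝 0)
  pos : 0 < K
  eq_zero : ∀ x v, K ≤ x → h x v = 0

/-- The spatial scale `n ^ (1 / (ρ + 2))`. -/
def scale (ρ : ℝ) (n : ℕ) : ℝ := (n : ℝ) ^ (1 / (ρ + 2))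

/-- The function `x ↦ x ^ (ρ + 1) ∫ h(x, v) dv`. -/
def sliceIntegral (ρ : ℝ) (h : ℝ → ℝ → ℝ) (x : ℝ) : ℝ :=
  x ^ (ρ + 1) * ∫ v in Set.Ioi 0, h x v

/-- The conditional expectation of `1 - h` at the `i`-th point, given that the bin starts at `s`. -/
def condFactor (ρ : ℝ) (h : ℝ → ℝ → ℝ) (n i : ℕ) (s : ℝ) : ℝ :=
  ∫ u, (1 - h (((i : ℝ) + 1) / scale ρ n)
    (n * (Real.exp (-(ρ * s)) - Real.exp (-(ρ * (s + u / ((i : ℝ) + 1))))))) ∂(expMeasure 1)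

/-- The centred split time `t_i - log (i + 1)`. -/
def centredTime {Ω : Type*} (E : ℕ → Ω → ℝ) (i : ℕ) (ω : Ω) : ℝ := splitTime E i ω - Real.log ((i : ℝ) + 1)

/-- The approximate compensator of the `i`-th point when the limit of the centred split times is
replaced by `θ`. -/
def approxCompensator (ρ : ℝ) (h : ℝ → ℝ → ℝ) (θ : ℝ) (n i : ℕ) : ℝ :=
  Real.exp (ρ * θ) / ρ *
    ((scale ρ n)⁻¹ * sliceIntegral ρ h (((i : ℝ) + 1) / scale ρ n))

variable {ρ K : ℝ} {h : ℝ → ℝ → ℝ} {H : ℝ → ℝ}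

theorem tendsto_scale (hρ : 0 < ρ) : Tendsto (scale ρ) atTop atTop :=
  (tendsto_rpow_atTop (by positivity)).comp tendsto_natCast_atTop_atTop

theorem scale_pos {n : ℕ} (hn : 0 < n) : 0 < scale ρ n :=
  Real.rpow_pos_of_pos (by exact_mod_cast hn) _

theorem scale_rpow (hρ : 0 < ρ) (n : ℕ) : scale ρ n ^ (ρ + 1) * scale ρ n = n := by
  rcases Nat.eq_zero_or_pos n with rfl | hn
  · have : (ρ + 2)⁻¹ ≠ 0 := by positivity
    simp [scale, Real.zero_rpow this]
  · rw [← Real.rpow_add_one (scale_pos hn).ne', scale, ← Real.rpow_mul (by positivity)]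
    have : 1 / (ρ + 2) * (ρ + 1 + 1) = 1 := by field_simp; ring
    rw [this, Real.rpow_one]

namespace IsDominated

theorem bound_nonneg (hh : IsDominated h H K) {v : ℝ} (hv : 0 < v) : 0 ≤ H v :=
  (hh.nonneg 0 v).trans (hh.le_bound 0 v hv)

theorem measurable_slice (hh : IsDominated h H K) (x : ℝ) : Measurable (h x) :=
  (hh.continuous.comp (Continuous.prodMk_right x)).measurable

theorem slice_integral_nonneg (hh : IsDominated h H K) (x : ℝ) :
    0 ≤ ∫ v in Set.Ioi 0, h x v :=
  integral_nonneg fun v => hh.nonneg x v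

theorem integrableOn_slice (hh : IsDominated h H K) (x : ℝ) : IntegrableOn (h x) (Set.Ioi 0) := by
  refine Integrable.mono' hh.integrable (hh.measurable_slice x).aestronglyMeasurable ?_
  filter_upwards [ae_restrict_mem measurableSet_Ioi] with v hv
  rw [Real.norm_of_nonneg (hh.nonneg x v)]
  exact hh.le_bound x v hv

theorem slice_integral_le (hh : IsDominated h H K) (x : ℝ) :
    ∫ v in Set.Ioi 0, h x v ≤ ∫ v in Set.Ioi 0, H v :=
  setIntegral_mono_on (hh.integrableOn_slice x) hh.integrable measurableSet_Ioi
    fun v hv => hh.le_bound x v hv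

theorem continuous_sliceIntegral (hh : IsDominated h H K) (hρ : 0 < ρ) :
    Continuous (sliceIntegral ρ h) := by
  refine (Real.continuous_rpow_const (by positivity)).mul ?_
  refine continuous_of_dominated (bound := H)
    (fun x => (hh.measurable_slice x).aestronglyMeasurable) (fun x => ?_) hh.integrable ?_
  · filter_upwards [ae_restrict_mem measurableSet_Ioi] with v hv
    rw [Real.norm_of_nonneg (hh.nonneg x v)]
    exact hh.le_bound x v hv
  · exact Eventually.of_forall fun v => hh.continuous.comp (Continuous.prodMk_left v)

theorem sliceIntegral_eq_zero (hh : IsDominated h H K) {x : ℝ} (hx : K ≤ x) :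
    sliceIntegral ρ h x = 0 := by
  simp [sliceIntegral, hh.eq_zero x _ hx]

theorem sliceIntegral_nonneg (hh : IsDominated h H K) {x : ℝ} (hx : 0 ≤ x) :
    0 ≤ sliceIntegral ρ h x :=
  mul_nonneg (Real.rpow_nonneg hx _) (hh.slice_integral_nonneg x)

theorem approxCompensator_nonneg (hh : IsDominated h H K) (hρ : 0 < ρ) (θ : ℝ) (n i : ℕ) :
    0 ≤ approxCompensator ρ h θ n i := by
  have : 0 ≤ scale ρ n := Real.rpow_nonneg (by positivity) _
  have h2 := hh.sliceIntegral_nonneg (ρ := ρ) (x := ((i : ℝ) + 1) / scale ρ n) (by positivity)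
  unfold approxCompensator
  positivity

theorem measurable_condFactor_integrand (hh : IsDominated h H K) (n i : ℕ) :
    Measurable (Function.uncurry fun s u : ℝ => 1 - h (((i : ℝ) + 1) / scale ρ n)
      (n * (Real.exp (-(ρ * s)) - Real.exp (-(ρ * (s + u / ((i : ℝ) + 1))))))) := by
  have : Continuous fun p : ℝ × ℝ => (((i : ℝ) + 1) / scale ρ n,
      (n : ℝ) * (Real.exp (-(ρ * p.1)) - Real.exp (-(ρ * (p.1 + p.2 / ((i : ℝ) + 1)))))) := by
    fun_prop
  exact (continuous_const.sub (hh.continuous.comp this)).measurable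

theorem measurable_condFactor (hh : IsDominated h H K) (n i : ℕ) :
    Measurable (condFactor ρ h n i) := by
  have : IsProbabilityMeasure (expMeasure 1) := isProbabilityMeasure_expMeasure one_pos
  exact (hh.measurable_condFactor_integrand n i).stronglyMeasurable.integral_prod_right.measurable

theorem condFactor_mem (hh : IsDominated h H K) (n i : ℕ) (s : ℝ) :
    condFactor ρ h n i s ∈ Set.Icc (0 : ℝ) 1 := by
  have : IsProbabilityMeasure (expMeasure 1) := isProbabilityMeasure_expMeasure one_pos
  refine ⟨integral_nonneg fun u => sub_nonneg.2 (hh.le_one _ _), ?_⟩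
  refine (integral_mono_of_nonneg (Eventually.of_forall fun u => sub_nonneg.2 (hh.le_one _ _))
    (integrable_const 1) (Eventually.of_forall fun u => ?_)).trans_eq (by simp)
  exact sub_le_self _ (hh.nonneg _ _)

/-- Linearization with `l = n exp (-ρ s)` and `p = (i+1)/ρ`, so that `δ = p/l`; the condition on `i`
says `1 ≤ p`. -/
theorem abs_condFactor_sub_le (hh : IsDominated h H K) (hρ : 0 < ρ) {n i : ℕ} (hn : 0 < n)
    (hi : ρ ≤ (i : ℝ) + 1) (s δ : ℝ) (hδ : δ = ((i : ℝ) + 1) / ρ / (n * Real.exp (-(ρ * s)))) :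
    |1 - condFactor ρ h n i s - δ * ∫ v in Set.Ioi 0, h (((i : ℝ) + 1) / scale ρ n) v| ≤
      δ * linearizationError H δ := by
  have : IsProbabilityMeasure (expMeasure 1) := isProbabilityMeasure_expMeasure one_pos
  have hn' : (0 : ℝ) < n := by exact_mod_cast hn
  set x := ((i : ℝ) + 1) / scale ρ n with hx
  have key := abs_integral_comp_one_sub_exp_sub_le (hh.measurable_slice x) hh.integrable
    (fun v _ => hh.nonneg x v) (hh.le_bound x) (l := n * Real.exp (-(ρ * s)))
    (p := ((i : ℝ) + 1) / ρ) (by positivity) ((one_le_div hρ).2 hi)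
  rw [← hδ] at key
  have h1 : ∀ u : ℝ, n * (Real.exp (-(ρ * s)) - Real.exp (-(ρ * (s + u / ((i : ℝ) + 1))))) =
      n * Real.exp (-(ρ * s)) * (1 - Real.exp (-(u / (((i : ℝ) + 1) / ρ)))) := fun u => by
    have : -(ρ * (s + u / ((i : ℝ) + 1))) = -(ρ * s) + -(u / (((i : ℝ) + 1) / ρ)) := by
      field_simp
      ring
    rw [this, Real.exp_add]
    ring
  have h2 : 1 - condFactor ρ h n i s = ∫ u, h x (n * Real.exp (-(ρ * s)) *
      (1 - Real.exp (-(u / (((i : ℝ) + 1) / ρ))))) ∂(expMeasure 1) := by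
    rw [condFactor, integral_sub (integrable_const 1)]
    · simp only [h1, integral_const, probReal_univ, smul_eq_mul, one_mul, sub_sub_cancel, ← hx]
    · refine Integrable.of_bound (C := 1) ?_ (Eventually.of_forall fun u => ?_)
      · refine ((hh.measurable_slice x).comp ?_).aestronglyMeasurable
        fun_prop
      · rw [Real.norm_of_nonneg (hh.nonneg _ _)]
        exact hh.le_one _ _
  rw [h2]
  exact key

/-- The exponent of the spatial scale is dictated here: with `n = N^{ρ+2}` the rate becomes the mesh
`N⁻¹` times a function of the rescaled position and the centred time. -/
theorem rate_eq (hρ : 0 < ρ) {n i : ℕ} (hn : 0 < n) (s : ℝ) :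
    ((i : ℝ) + 1) / ρ / (n * Real.exp (-(ρ * s))) =
      (scale ρ n)⁻¹ * ((((i : ℝ) + 1) / scale ρ n) ^ (ρ + 1) / ρ *
        Real.exp (ρ * (s - Real.log ((i : ℝ) + 1)))) := by
  have hN := scale_pos (ρ := ρ) hn
  have hi : (0 : ℝ) < (i : ℝ) + 1 := by positivity
  have h1 : Real.exp (ρ * (s - Real.log ((i : ℝ) + 1))) =
      Real.exp (ρ * s) / ((i : ℝ) + 1) ^ ρ := by
    rw [mul_sub, Real.exp_sub, Real.rpow_def_of_pos hi, mul_comm ρ (Real.log _)]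
  have h2 : 0 < ((i : ℝ) + 1) ^ ρ := by positivity
  have h3 : 0 < scale ρ n ^ (ρ + 1) := by positivity
  rw [h1, Real.div_rpow hi.le hN.le, Real.rpow_add_one hi.ne', ← scale_rpow hρ n, Real.exp_neg]
  field_simp

/-- One-step comparison between conditional factors and exponentials of approximate
compensators. -/
theorem abs_condFactor_sub_exp_le (hh : IsDominated h H K) (hρ : 0 < ρ) {n i : ℕ} (hn : 0 < n)
    (hi : ρ ≤ (i : ℝ) + 1) {t θ B η : ℝ}
    (hx : ((i : ℝ) + 1) / scale ρ n ≤ K + 1)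
    (htB : Real.exp (ρ * t) ≤ B) (hθB : Real.exp (ρ * θ) ≤ B)
    (hη : |Real.exp (ρ * t) - Real.exp (ρ * θ)| ≤ η)
    (hN : (K + 1) ^ (ρ + 1) / ρ * B * (∫ v in Set.Ioi 0, H v) ≤ scale ρ n) :
    |condFactor ρ h n i (t + Real.log ((i : ℝ) + 1)) - Real.exp (-approxCompensator ρ h θ n i)| ≤
      (scale ρ n)⁻¹ * ((K + 1) ^ (ρ + 1) / ρ * B *
          linearizationError H ((scale ρ n)⁻¹ * ((K + 1) ^ (ρ + 1) / ρ * B)) +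
        (K + 1) ^ (ρ + 1) / ρ * (∫ v in Set.Ioi 0, H v) * η +
        ((K + 1) ^ (ρ + 1) / ρ * B * (∫ v in Set.Ioi 0, H v)) ^ 2 * (scale ρ n)⁻¹) := by
  set N := scale ρ n with hNdef
  have hN0 : 0 < N := scale_pos hn
  have hK := hh.pos
  set X := (K + 1) ^ (ρ + 1) / ρ with hX
  have hX0 : 0 ≤ X := by positivity
  set J := ∫ v in Set.Ioi 0, H v with hJ
  set x := ((i : ℝ) + 1) / N with hxdef
  have hx0 : 0 ≤ x := by positivity
  set I := ∫ v in Set.Ioi 0, h x v with hI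
  have hI0 : 0 ≤ I := hh.slice_integral_nonneg x
  have hIJ : I ≤ J := hh.slice_integral_le x
  have hJ0 : 0 ≤ J := hI0.trans hIJ
  have hB0 : 0 ≤ B := (Real.exp_pos _).le.trans htB
  have hη0 : 0 ≤ η := (abs_nonneg _).trans hη
  have hxX : x ^ (ρ + 1) / ρ ≤ X :=
    div_le_div_of_nonneg_right (Real.rpow_le_rpow hx0 hx (by positivity)) hρ.le
  have hxX0 : 0 ≤ x ^ (ρ + 1) / ρ := by positivity
  set δ := N⁻¹ * (x ^ (ρ + 1) / ρ * Real.exp (ρ * t)) with hδ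
  have hδ0 : 0 ≤ δ := by positivity
  have hδD : δ ≤ N⁻¹ * (X * B) :=
    mul_le_mul_of_nonneg_left (mul_le_mul hxX htB (Real.exp_pos _).le hX0) (inv_nonneg.2 hN0.le)
  -- Three errors are added: linearizing the conditional factor (`h1`, `h2`), replacing `t` by `θ`
  -- (`h3`), and replacing `1 - d` by `exp (-d)` (`h4`, which needs `d ≤ 1`, ensured by `hN`).
  have h1 := hh.abs_condFactor_sub_le hρ hn hi (t + Real.log ((i : ℝ) + 1)) δ (by
    rw [rate_eq hρ hn, add_sub_cancel_right])
  change |_ - δ * I| ≤ _ at h1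
  set d := approxCompensator ρ h θ n i with hd
  have hd' : d = N⁻¹ * (x ^ (ρ + 1) / ρ * Real.exp (ρ * θ)) * I := by
    rw [hd, approxCompensator, sliceIntegral]
    ring
  have hd0 : 0 ≤ d := hh.approxCompensator_nonneg hρ θ n i
  have hdle : d ≤ N⁻¹ * (X * B * J) := by
    rw [hd', mul_assoc]
    gcongr
  have hd1 : d ≤ 1 := hdle.trans (by
    rw [inv_mul_le_iff₀ hN0, mul_one]
    exact hN)
  have h2 : δ * linearizationError H δ ≤
      N⁻¹ * (X * B * linearizationError H (N⁻¹ * (X * B))) := by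
    rw [← mul_assoc]
    have h3 := linearizationError_mono hh.integrable (fun v hv => hh.bound_nonneg hv) hδ0 hδD
    have h4 := linearizationError_nonneg (H := H) (fun v hv => hh.bound_nonneg hv) hδ0
    gcongr
  have h3 : |δ * I - d| ≤ N⁻¹ * (X * J * η) := by
    have : δ * I - d = N⁻¹ * (x ^ (ρ + 1) / ρ * I * (Real.exp (ρ * t) - Real.exp (ρ * θ))) := by
      rw [hd', hδ]; ring
    rw [this, abs_mul, abs_mul, abs_of_pos (inv_pos.2 hN0), abs_of_nonneg (by positivity)]
    gcongr
  have h4 : |Real.exp (-d) - 1 - -d| ≤ N⁻¹ * ((X * B * J) ^ 2 * N⁻¹) := by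
    refine (Real.abs_exp_sub_one_sub_id_le (by rwa [abs_neg, abs_of_nonneg hd0])).trans ?_
    rw [neg_sq]
    calc d ^ 2 ≤ (N⁻¹ * (X * B * J)) ^ 2 := by gcongr
      _ = _ := by ring
  rw [mul_add, mul_add]
  rw [abs_le] at h1 h3 h4 ⊢
  constructor <;> linarith [h1.1, h1.2, h3.1, h3.2, h4.1, h4.2]

/-- There are at most `(K + 1) N` terms, each `N⁻¹` times a small quantity. The part due to freezing
the centred time at `m` is small for large `m` by the Cauchy property, uniformly in `n`; the other
parts vanish as `n → ∞`, uniformly in `m`. -/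
theorem tendsto_sum_abs_condFactor_sub (hh : IsDominated h H K) (hρ : 0 < ρ) {t : ℕ → ℝ} {l : ℝ}
    (ht : Tendsto t atTop (𝓝 l)) :
    Tendsto (fun p : ℕ × ℕ => ∑ i ∈ Finset.Ico p.1 ⌈K * scale ρ p.2⌉₊,
      |condFactor ρ h p.2 i (t i + Real.log ((i : ℝ) + 1)) -
        Real.exp (-approxCompensator ρ h (t p.1) p.2 i)|) (atTop ×ˢ atTop) (𝓝 0) := by
  have hK := hh.pos
  have het : Tendsto (fun i => Real.exp (ρ * t i)) atTop (𝓝 (Real.exp (ρ * l))) :=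
    (Real.continuous_exp.tendsto _).comp (ht.const_mul ρ)
  obtain ⟨B, hB⟩ := het.bddAbove_range
  have hB' : ∀ i, Real.exp (ρ * t i) ≤ B := fun i => hB ⟨i, rfl⟩
  have hB0 : 0 ≤ B := (Real.exp_pos _).le.trans (hB' 0)
  set X := (K + 1) ^ (ρ + 1) / ρ with hX
  have hX0 : 0 ≤ X := by positivity
  set J := ∫ v in Set.Ioi 0, H v with hJ
  have hJ0 : 0 ≤ J := (hh.slice_integral_nonneg 0).trans (hh.slice_integral_le 0)
  have hNinv : Tendsto (fun n => (scale ρ n)⁻¹) atTop (𝓝 0) :=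
    tendsto_inv_atTop_zero.comp (tendsto_scale hρ)
  have hrest : Tendsto (fun n => (K + 1) * (X * B *
      linearizationError H ((scale ρ n)⁻¹ * (X * B)) + (X * B * J) ^ 2 * (scale ρ n)⁻¹))
      atTop (𝓝 0) := by
    have h1 := tendsto_linearizationError hh.integrable
      (δ := fun n => (scale ρ n)⁻¹ * (X * B)) (fun n => by
        have : 0 ≤ scale ρ n := Real.rpow_nonneg (by positivity) _
        positivity) (by simpa using hNinv.mul_const (X * B))
    simpa using ((h1.const_mul (X * B)).add (hNinv.const_mul ((X * B * J) ^ 2))).const_mul (K + 1)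
  rw [Metric.tendsto_nhds]
  intro ε hε
  obtain ⟨η, hη0, hη⟩ : ∃ η > 0, (K + 1) * (X * J * η) < ε / 2 := by
    -- The `+ 1` covers the case `X * J = 0`.
    refine ⟨ε / (2 * ((K + 1) * (X * J) + 1)), by positivity, ?_⟩
    have : (K + 1) * (X * J * (ε / (2 * ((K + 1) * (X * J) + 1)))) =
        ε / 2 * ((K + 1) * (X * J) / ((K + 1) * (X * J) + 1)) := by field_simp
    rw [this]
    refine mul_lt_of_lt_one_right (by positivity) ?_
    rw [div_lt_one (by positivity)]
    linarith
  obtain ⟨m₀, hm₀⟩ := Metric.cauchySeq_iff.1 het.cauchySeq η hη0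
  have hm : ∀ᶠ m : ℕ in atTop, m₀ ≤ m ∧ ρ ≤ m :=
    (eventually_ge_atTop m₀).and (tendsto_natCast_atTop_atTop.eventually_ge_atTop ρ)
  have hn : ∀ᶠ n : ℕ in atTop, 0 < n ∧ 1 ≤ scale ρ n ∧ X * B * J ≤ scale ρ n ∧
      (K + 1) * (X * B * linearizationError H ((scale ρ n)⁻¹ * (X * B)) +
        (X * B * J) ^ 2 * (scale ρ n)⁻¹) < ε / 2 :=
    (eventually_gt_atTop 0).and (((tendsto_scale hρ).eventually_ge_atTop 1).and
      (((tendsto_scale hρ).eventually_ge_atTop _).and (hrest.eventually_lt_const (by positivity))))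
  filter_upwards [hm.prod_mk hn] with ⟨m, n⟩ ⟨⟨hm1, hm2⟩, hn0, hn1, hn2, hn3⟩
  simp only at hm1 hm2 hn0 hn1 hn2 hn3 ⊢
  rw [Real.dist_0_eq_abs, abs_of_nonneg (Finset.sum_nonneg fun _ _ => abs_nonneg _)]
  set N := scale ρ n with hN
  have hN0 : 0 < N := by linarith
  have hL : ((⌈K * N⌉₊ : ℕ) : ℝ) < K * N + 1 := Nat.ceil_lt_add_one (by positivity)
  have hLN : ((⌈K * N⌉₊ : ℕ) : ℝ) * N⁻¹ ≤ K + 1 := by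
    rw [← div_eq_mul_inv, div_le_iff₀ hN0]; nlinarith
  set b := X * B * linearizationError H (N⁻¹ * (X * B)) + X * J * η + (X * B * J) ^ 2 * N⁻¹
    with hb
  have hb0 : 0 ≤ b := by
    have := linearizationError_nonneg (H := H) (fun v hv => hh.bound_nonneg hv)
      (δ := N⁻¹ * (X * B)) (by positivity)
    positivity
  have hterm : ∀ i ∈ Finset.Ico m ⌈K * N⌉₊,
      |condFactor ρ h n i (t i + Real.log ((i : ℝ) + 1)) -
        Real.exp (-approxCompensator ρ h (t m) n i)| ≤ N⁻¹ * b := fun i hi => by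
    obtain ⟨hi1, hi2⟩ := Finset.mem_Ico.1 hi
    have hi1' : (m : ℝ) ≤ i := by exact_mod_cast hi1
    have hi2' : (i : ℝ) + 1 ≤ (⌈K * N⌉₊ : ℕ) := by exact_mod_cast hi2
    refine hh.abs_condFactor_sub_exp_le hρ hn0 (by linarith) ?_ (hB' i) (hB' m) ?_ hn2
    · rw [← hN, div_le_iff₀ hN0]; nlinarith
    · exact (hm₀ i (hm1.trans hi1) m hm1).le
  calc _ ≤ ∑ i ∈ Finset.Ico m ⌈K * N⌉₊, N⁻¹ * b := Finset.sum_le_sum hterm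
    _ ≤ ∑ i ∈ Finset.range ⌈K * N⌉₊, N⁻¹ * b := by
        refine Finset.sum_le_sum_of_subset_of_nonneg ?_ fun _ _ _ => by positivity
        rw [Finset.range_eq_Ico]
        exact Finset.Ico_subset_Ico_left (Nat.zero_le _)
    _ = (⌈K * N⌉₊ : ℕ) * N⁻¹ * b := by
        rw [Finset.sum_const, Finset.card_range, nsmul_eq_mul]; ring
    _ ≤ (K + 1) * b := by gcongr
    _ < ε := by rw [hb]; linarith

theorem tendsto_sum_approxCompensator (hh : IsDominated h H K) (hρ : 0 < ρ) {t : ℕ → ℝ} {l : ℝ}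
    (ht : Tendsto t atTop (𝓝 l)) :
    Tendsto (fun p : ℕ × ℕ => ∑ i ∈ Finset.range ⌈K * scale ρ p.2⌉₊,
      approxCompensator ρ h (t p.1) p.2 i) (atTop ×ˢ atTop)
      (𝓝 (Real.exp (ρ * l) / ρ * ∫ x in Set.Ioi 0, sliceIntegral ρ h x)) := by
  have het : Tendsto (fun i => Real.exp (ρ * t i) / ρ) atTop (𝓝 (Real.exp (ρ * l) / ρ)) :=
    ((Real.continuous_exp.tendsto _).comp (ht.const_mul ρ)).div_const ρ
  have hR := tendsto_riemannSum (hh.continuous_sliceIntegral hρ) hh.pos.le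
    (fun x hx => hh.sliceIntegral_eq_zero hx) (tendsto_scale hρ)
  refine ((het.comp tendsto_fst).mul (hR.comp tendsto_snd)).congr fun p => ?_
  exact Finset.mul_sum _ _ _

/-- Both the mesh and the rescaled position of a fixed index tend to `0`, so finitely many
compensators can be added or dropped. -/
theorem tendsto_approxCompensator (hh : IsDominated h H K) (hρ : 0 < ρ) (θ : ℝ) (i : ℕ) :
    Tendsto (fun n => approxCompensator ρ h θ n i) atTop (𝓝 0) := by
  have hNinv : Tendsto (fun n => (scale ρ n)⁻¹) atTop (𝓝 0) :=
    tendsto_inv_atTop_zero.comp (tendsto_scale hρ)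
  have h1 : Tendsto (fun n => ((i : ℝ) + 1) / scale ρ n) atTop (𝓝 0) := by
    simpa [div_eq_mul_inv] using hNinv.const_mul ((i : ℝ) + 1)
  have h2 := ((hh.continuous_sliceIntegral hρ).tendsto 0).comp h1
  simpa [approxCompensator] using (hNinv.mul h2).const_mul (Real.exp (ρ * θ) / ρ)

end IsDominated

end

/-! ### Convergence of the expected product over the points -/

section

variable {Ω : Type*} {mΩ : MeasurableSpace Ω} {μ : Measure Ω} {E : ℕ → Ω → ℝ}
  {ρ K : ℝ} {h : ℝ → ℝ → ℝ} {H : ℝ → ℝ}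

/-- The factor `1 - h` at the `i`-th point of the point process. -/
def pointFactor (ρ : ℝ) (E : ℕ → Ω → ℝ) (h : ℝ → ℝ → ℝ) (n i : ℕ) (ω : Ω) : ℝ :=
  1 - h (((i : ℝ) + 1) / scale ρ n) (n * binProb ρ E i ω)

theorem splitTime_succ (E : ℕ → Ω → ℝ) (i : ℕ) (ω : Ω) :
    splitTime E (i + 1) ω = splitTime E i ω + E i ω / ((i : ℝ) + 1) := by
  simp [splitTime, Finset.sum_range_succ]

theorem tendsto_centredTime {ω : Ω} {l : ℝ}
    (hω : Tendsto (fun n : ℕ => martingaleM E n ω) atTop (𝓝 l)) :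
    Tendsto (fun n : ℕ => centredTime E n ω) atTop (𝓝 l) := by
  have h1 : Tendsto (fun n : ℕ => Real.log ((n : ℝ) + 1) - Real.log n) atTop (𝓝 0) :=
    (Real.tendsto_log_comp_add_sub_log 1).comp tendsto_natCast_atTop_atTop
  have h2 := hω.sub h1
  rw [sub_zero] at h2
  refine h2.congr fun n => ?_
  simp only [martingaleM, centredTime]
  ring

namespace IsDominated

theorem pointFactor_mem (hh : IsDominated h H K) (n i : ℕ) (ω : Ω) :
    pointFactor ρ E h n i ω ∈ Set.Icc (0 : ℝ) 1 :=
  ⟨sub_nonneg.2 (hh.le_one _ _), sub_le_self _ (hh.nonneg _ _)⟩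

theorem tendsto_pointFactor (hh : IsDominated h H K) {i : ℕ} {ω : Ω}
    (hω : 0 < binProb ρ E i ω) :
    Tendsto (fun n => pointFactor ρ E h n i ω) atTop (𝓝 1) := by
  have h1 : Tendsto (fun n : ℕ => (n : ℝ) * binProb ρ E i ω) atTop atTop :=
    tendsto_natCast_atTop_atTop.atTop_mul_const hω
  have h2 : Tendsto (fun n : ℕ => h (((i : ℝ) + 1) / scale ρ n) (n * binProb ρ E i ω))
      atTop (𝓝 0) := by
    refine squeeze_zero' (Eventually.of_forall fun n => hh.nonneg _ _) ?_
      (hh.tendsto_bound.comp h1)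
    filter_upwards [eventually_gt_atTop 0] with n hn
    have : (0 : ℝ) < n := by exact_mod_cast hn
    exact hh.le_bound _ _ (by positivity)
  simpa [pointFactor] using h2.const_sub 1

theorem measurable_pointFactor (hh : IsDominated h H K) (hE : ∀ i, Measurable (E i)) (n i : ℕ) :
    Measurable[past E hE (i + 1)] (pointFactor ρ E h n i) := by
  have h1 : Measurable[past E hE (i + 1)] fun ω => (splitTime E i ω, splitTime E (i + 1) ω) :=
    ((measurable_splitTime_past hE i).mono ((past E hE).mono i.le_succ) le_rfl).prodMk
      (measurable_splitTime_past hE (i + 1))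
  have h2 : Measurable fun p : ℝ × ℝ => 1 - h (((i : ℝ) + 1) / scale ρ n)
      (n * (Real.exp (-(ρ * p.1)) - Real.exp (-(ρ * p.2)))) :=
    ((hh.measurable_slice _).comp (by fun_prop)).const_sub 1
  exact h2.comp h1

theorem integral_mul_pointFactor [IsProbabilityMeasure μ] (hh : IsDominated h H K)
    (hE : ∀ i, Measurable (E i)) (hlaw : ∀ i, HasLaw (E i) (expMeasure 1) μ)
    (hindep : iIndepFun E μ) (n i : ℕ) {G : Ω → ℝ} (hG : Measurable[past E hE i] G)
    (hG1 : ∀ ω, |G ω| ≤ 1) :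
    ∫ ω, G ω * pointFactor ρ E h n i ω ∂μ =
      ∫ ω, G ω * condFactor ρ h n i (splitTime E i ω) ∂μ := by
  have key := integral_mul_comp_of_indep ((past E hE).le i) hG (measurable_splitTime_past hE i)
    (hE i) (indep_past hE hindep i) (hh.measurable_condFactor_integrand (ρ := ρ) n i) hG1
    (fun s u => by
      rw [abs_of_nonneg (sub_nonneg.2 (hh.le_one _ _))]
      exact sub_le_self _ (hh.nonneg _ _))
  rw [(hlaw i).map_eq] at key
  simp only [condFactor]
  rw [← key]
  simp only [pointFactor, binProb, splitTime_succ]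

theorem measurable_centredTime (hE : ∀ i, Measurable (E i)) (m : ℕ) :
    Measurable[past E hE m] (centredTime E m) :=
  (measurable_id.sub_const _).comp (measurable_splitTime_past hE m)

/-- Convergence of `𝔼 ∏ (1 - h)` over the points of the point process. -/
theorem tendsto_integral_prod_pointFactor [IsProbabilityMeasure μ] (hh : IsDominated h H K)
    (hρ : 0 < ρ) (hE : ∀ i, Measurable (E i)) (hlaw : ∀ i, HasLaw (E i) (expMeasure 1) μ)
    (hindep : iIndepFun E μ) :
    Tendsto (fun n : ℕ => ∫ ω, ∏ i ∈ Finset.range ⌈K * scale ρ n⌉₊, pointFactor ρ E h n i ω ∂μ)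
      atTop (𝓝 (∫ ω, Real.exp (-(Real.exp (ρ * limitM E ω) / ρ *
        ∫ x in Set.Ioi 0, sliceIntegral ρ h x)) ∂μ)) := by
  have hK := hh.pos
  set L : ℕ → ℕ := fun n => ⌈K * scale ρ n⌉₊ with hL
  have hLtop : Tendsto L atTop atTop :=
    tendsto_nat_ceil_atTop.comp ((tendsto_scale hρ).const_mul_atTop hK)
  set Z : ℕ → ℕ → Ω → ℝ := pointFactor ρ E h with hZ
  set q : ℕ → ℕ → Ω → ℝ := fun n i ω => condFactor ρ h n i (splitTime E i ω) with hq
  set c : ℕ → ℕ → ℕ → Ω → ℝ := fun m n i ω =>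
    Real.exp (-approxCompensator ρ h (centredTime E m ω) n i) with hc
  have hθ : ∀ᵐ ω ∂μ, Tendsto (fun n : ℕ => centredTime E n ω) atTop (𝓝 (limitM E ω)) :=
    (ae_tendsto_martingaleM hE hlaw hindep).mono fun ω => tendsto_centredTime
  have hpos : ∀ᵐ ω ∂μ, ∀ i, 0 < binProb ρ E i ω := by
    rw [ae_all_iff]
    intro i
    have : ∀ᵐ ω ∂μ, 0 < E i ω := by
      have := ae_expMeasure_one_pos
      rw [← (hlaw i).map_eq] at this
      exact ae_of_ae_map (hlaw i).aemeasurable this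
    filter_upwards [this] with ω hω
    rw [binProb, sub_pos, Real.exp_lt_exp, splitTime_succ, neg_lt_neg_iff]
    refine mul_lt_mul_of_pos_left ?_ hρ
    have : 0 < E i ω / ((i : ℝ) + 1) := by positivity
    linarith
  have hZm : ∀ n i, Measurable (Z n i) := fun n i =>
    (hh.measurable_pointFactor hE n i).mono ((past E hE).le _) le_rfl
  have hqm : ∀ n i, Measurable[past E hE i] (q n i) := fun n i =>
    (hh.measurable_condFactor n i).comp (measurable_splitTime_past hE i)
  have hcm : ∀ m n i, Measurable[past E hE m] (c m n i) := fun m n i => by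
    have : Measurable fun θ : ℝ => Real.exp (-approxCompensator ρ h θ n i) := by
      unfold approxCompensator
      fun_prop
    exact this.comp (measurable_centredTime hE m)
  have hqm' : ∀ n i, Measurable (q n i) := fun n i => (hqm n i).mono ((past E hE).le _) le_rfl
  have hcm' : ∀ m n i, Measurable (c m n i) := fun m n i =>
    (hcm m n i).mono ((past E hE).le _) le_rfl
  have hZ01 : ∀ n i ω, Z n i ω ∈ Set.Icc (0 : ℝ) 1 := fun n i ω => hh.pointFactor_mem n i ω
  have hq01 : ∀ n i ω, q n i ω ∈ Set.Icc (0 : ℝ) 1 := fun n i ω => hh.condFactor_mem n i _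
  have hc01 : ∀ m n i ω, c m n i ω ∈ Set.Icc (0 : ℝ) 1 := fun m n i ω =>
    ⟨(Real.exp_pos _).le, Real.exp_le_one_iff.2
      (neg_nonpos.2 (hh.approxCompensator_nonneg hρ _ _ _))⟩
  have hprod01 : ∀ (s : Finset ℕ) (g : ℕ → ℝ), (∀ i, g i ∈ Set.Icc (0 : ℝ) 1) →
      ∏ i ∈ s, g i ∈ Set.Icc (0 : ℝ) 1 := fun s g hg =>
    ⟨Finset.prod_nonneg fun i _ => (hg i).1,
      Finset.prod_le_one (fun i _ => (hg i).1) fun i _ => (hg i).2⟩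
  set T := ∫ ω, Real.exp (-(Real.exp (ρ * limitM E ω) / ρ *
        ∫ x in Set.Ioi 0, sliceIntegral ρ h x)) ∂μ with hT
  -- the products of the approximating factors
  have hU : Tendsto (fun p : ℕ × ℕ => ∫ ω, ∏ i ∈ Finset.range (L p.2), c p.1 p.2 i ω ∂μ)
      (atTop ×ˢ atTop) (𝓝 T) := by
    refine tendsto_integral_filter_of_dominated_convergence (fun _ => 1)
      (Eventually.of_forall fun p => (Finset.measurable_fun_prod _ fun i _ =>
        hcm' _ _ i).aestronglyMeasurable)
      (Eventually.of_forall fun p => Eventually.of_forall fun ω => ?_) (integrable_const 1) ?_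
    · have := hprod01 (Finset.range (L p.2)) (fun i => c p.1 p.2 i ω) fun i => hc01 _ _ i ω
      rw [Real.norm_of_nonneg this.1]
      exact this.2
    · filter_upwards [hθ] with ω hω
      simp only [hc, ← Real.exp_sum, Finset.sum_neg_distrib]
      exact (Real.continuous_exp.tendsto _).comp (hh.tendsto_sum_approxCompensator hρ hω).neg
  -- the error of the approximation of the conditional factors
  have hS : ∀ ε : ℝ, 0 < ε → Tendsto (fun p : ℕ × ℕ => ∫ ω, min 1
      ((∑ i ∈ Finset.Ico p.1 (L p.2), |q p.2 i ω - c p.1 p.2 i ω|) / ε) ∂μ)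
      (atTop ×ˢ atTop) (𝓝 0) := fun ε hε => by
    rw [← integral_zero Ω ℝ (μ := μ)]
    refine tendsto_integral_filter_of_dominated_convergence (fun _ => 1)
      (Eventually.of_forall fun p => (measurable_const.min ((Finset.measurable_fun_sum _ fun i _ =>
        ((hqm' _ i).sub (hcm' _ _ i)).abs).div_const ε)).aestronglyMeasurable)
      (Eventually.of_forall fun p => Eventually.of_forall fun ω => ?_) (integrable_const 1) ?_
    · rw [Real.norm_of_nonneg (le_min zero_le_one
        (div_nonneg (Finset.sum_nonneg fun _ _ => abs_nonneg _) hε.le))]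
      exact min_le_left _ _
    · filter_upwards [hθ] with ω hω
      have h1 := hh.tendsto_sum_abs_condFactor_sub hρ hω
      simp only [centredTime, sub_add_cancel] at h1
      have h2 := (tendsto_const_nhds (x := (1 : ℝ))).min (h1.div_const ε)
      rw [zero_div, min_eq_right zero_le_one] at h2
      exact h2
  -- the first `m` points are negligible
  have hV : ∀ m, Tendsto (fun n => ∫ ω, (∏ i ∈ Finset.range m, Z n i ω) *
      ∏ i ∈ Finset.Ico m (L n), c m n i ω ∂μ - ∫ ω, ∏ i ∈ Finset.range (L n), c m n i ω ∂μ)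
      atTop (𝓝 0) := fun m => by
    have hb : ∀ g : Ω → ℝ, Measurable g → (∀ ω, g ω ∈ Set.Icc (0 : ℝ) 1) → Integrable g μ :=
      fun g hg hg1 => Integrable.of_bound hg.aestronglyMeasurable 1 (Eventually.of_forall
        fun ω => by rw [Real.norm_of_nonneg (hg1 ω).1]; exact (hg1 ω).2)
    have hA01 : ∀ n ω, (∏ i ∈ Finset.range m, Z n i ω) * ∏ i ∈ Finset.Ico m (L n), c m n i ω ∈
        Set.Icc (0 : ℝ) 1 := fun n ω => by
      have h1 := hprod01 (Finset.range m) (fun i => Z n i ω) fun i => hZ01 n i ω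
      have h2 := hprod01 (Finset.Ico m (L n)) (fun i => c m n i ω) fun i => hc01 m n i ω
      exact ⟨mul_nonneg h1.1 h2.1, mul_le_one₀ h1.2 h2.1 h2.2⟩
    have hAm : ∀ n, Measurable fun ω => (∏ i ∈ Finset.range m, Z n i ω) *
        ∏ i ∈ Finset.Ico m (L n), c m n i ω := fun n =>
      (Finset.measurable_fun_prod _ fun i _ => hZm n i).mul
        (Finset.measurable_fun_prod _ fun i _ => hcm' m n i)
    have hBm : ∀ n, Measurable fun ω => ∏ i ∈ Finset.range (L n), c m n i ω := fun n =>
      Finset.measurable_fun_prod _ fun i _ => hcm' m n i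
    have hB01 : ∀ n ω, ∏ i ∈ Finset.range (L n), c m n i ω ∈ Set.Icc (0 : ℝ) 1 := fun n ω =>
      hprod01 _ _ fun i => hc01 m n i ω
    simp_rw [← integral_sub (hb _ (hAm _) (hA01 _)) (hb _ (hBm _) (hB01 _))]
    rw [← integral_zero Ω ℝ (μ := μ)]
    refine tendsto_integral_of_dominated_convergence (fun _ => 1)
      (fun n => ((hAm n).sub (hBm n)).aestronglyMeasurable) (integrable_const 1)
      (fun n => Eventually.of_forall fun ω => ?_) ?_
    · rw [Real.norm_eq_abs, abs_le]
      have h1 := hA01 n ω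
      have h2 := hB01 n ω
      constructor <;> linarith [h1.1, h1.2, h2.1, h2.2]
    · filter_upwards [hpos] with ω hω
      have h1 : Tendsto (fun n => ∏ i ∈ Finset.range m, Z n i ω) atTop
          (𝓝 (∏ i ∈ Finset.range m, 1)) :=
        tendsto_finsetProd _ fun i _ => hh.tendsto_pointFactor (hω i)
      have h2 : Tendsto (fun n => ∏ i ∈ Finset.range m, c m n i ω) atTop
          (𝓝 (∏ i ∈ Finset.range m, 1)) :=
        tendsto_finsetProd _ fun i _ => by
          have := (Real.continuous_exp.tendsto _).comp
            (hh.tendsto_approxCompensator hρ (centredTime E m ω) i).neg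
          rw [neg_zero, Real.exp_zero] at this
          exact this
      have h3 := (h1.sub h2).abs
      simp only [sub_self, abs_zero] at h3
      refine squeeze_zero_norm' ?_ h3
      filter_upwards [hLtop.eventually_ge_atTop m] with n hn
      rw [← Finset.prod_range_mul_prod_Ico _ hn, ← sub_mul, norm_mul, Real.norm_eq_abs]
      have h4 := hprod01 (Finset.Ico m (L n)) (fun i => c m n i ω) fun i => hc01 m n i ω
      refine mul_le_of_le_one_right (abs_nonneg _) ?_
      rw [Real.norm_of_nonneg h4.1]
      exact h4.2
  rw [Metric.tendsto_nhds]
  intro ε hε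
  have hε4 : 0 < ε / 4 := by positivity
  -- The estimate `hV` is not uniform in `m`. Currying the product filter fixes one `m` that is good
  -- for all large `n`, before `n → ∞` is used in `hV`.
  obtain ⟨m, hm⟩ := (((hS _ hε4).eventually_lt_const hε4).and
    ((Metric.tendsto_nhds.1 hU) _ hε4)).curry.exists
  filter_upwards [hm, (Metric.tendsto_nhds.1 (hV m)) _ hε4, hLtop.eventually_ge_atTop m]
    with n ⟨hn1, hn2⟩ hn3 hn4
  have key := abs_integral_prod_sub_le (past E hE) (Z := Z n) (q := q n) (c := c m n) hn4
    (fun i => hh.measurable_pointFactor hE n i) (hqm n) (hcm m n) (hZ01 n) (hq01 n) (hc01 m n)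
    (fun i _ G hG hG1 => hh.integral_mul_pointFactor hE hlaw hindep n i hG hG1) hε4
  rw [Real.dist_eq] at hn2 hn3 ⊢
  rw [sub_zero] at hn3
  rw [abs_lt] at hn2 hn3 ⊢
  rw [abs_le] at key
  constructor <;> linarith [key.1, key.2, hn2.1, hn2.2, hn3.1, hn3.2]

end IsDominated

end

/-! ### Laplace functionals: dominated case and infinite intensity -/

theorem expNeg_ofReal {a : ℝ} (ha : 0 ≤ a) : expNeg (ENNReal.ofReal a) = Real.exp (-a) := by
  simp [expNeg, ENNReal.toReal_ofReal ha]

theorem expNeg_nonneg (a : ℝ≥0∞) : 0 ≤ expNeg a := by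
  unfold expNeg
  split_ifs
  · exact le_rfl
  · exact (Real.exp_pos _).le

section Laplace

variable {Ω : Type*} {mΩ : MeasurableSpace Ω} {μ : Measure Ω} {E : ℕ → Ω → ℝ}
  {ρ K : ℝ} {f : ℝ × ℝ → ℝ} {H : ℝ → ℝ}

/-- An index `i ≥ K N` gives a first coordinate at least `K`, so only finitely many points
contribute. -/
theorem expNeg_lintegral_pointProcess (hf0 : ∀ p, 0 ≤ f p)
    (hfK : ∀ x v, K ≤ x → f (x, v) = 0) {n : ℕ} (hn : 0 < n) (ω : Ω) :
    expNeg (∫⁻ p, ENNReal.ofReal (f p) ∂(pointProcess ρ E n ω)) =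
      ∏ i ∈ Finset.range ⌈K * scale ρ n⌉₊,
        pointFactor ρ E (fun x v => 1 - Real.exp (-f (x, v))) n i ω := by
  have hN : 0 < scale ρ n := scale_pos hn
  rw [pointProcess, lintegral_sum_measure]
  simp only [lintegral_dirac, pointFactor, sub_sub_cancel]
  rw [tsum_eq_sum (s := Finset.range ⌈K * scale ρ n⌉₊), ← ENNReal.ofReal_sum_of_nonneg
    fun i _ => hf0 _, expNeg_ofReal (Finset.sum_nonneg fun i _ => hf0 _), ← Finset.sum_neg_distrib,
    Real.exp_sum]
  · rfl
  · intro i hi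
    rw [hfK, ENNReal.ofReal_zero]
    have h1 : K * scale ρ n ≤ i := by
      rw [Finset.mem_range, not_lt] at hi
      exact (Nat.le_ceil _).trans (by exact_mod_cast hi)
    rw [scale] at h1 hN
    rw [le_div_iff₀ hN]
    linarith

theorem intensityIntegral_eq (hρ : 0 < ρ)
    (hh : IsDominated (fun x v => 1 - Real.exp (-f (x, v))) H K) (hf : Continuous f) :
    intensityIntegral ρ f = ENNReal.ofReal
      (∫ x in Set.Ioi 0, sliceIntegral ρ (fun x v => 1 - Real.exp (-f (x, v))) x) := by
  set h : ℝ → ℝ → ℝ := fun x v => 1 - Real.exp (-f (x, v)) with hhdef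
  have hrestr : (volume : Measure (ℝ × ℝ)).restrict quadrant =
      ((volume : Measure ℝ).restrict (Set.Ioi 0)).prod
        ((volume : Measure ℝ).restrict (Set.Ioi 0)) := by
    rw [Measure.restrict_congr_set (Ioi_ae_eq_Ici (μ := (volume : Measure ℝ)) (a := 0)),
      Measure.prod_restrict]
    rfl
  have hmeas : Measurable fun p : ℝ × ℝ =>
      ENNReal.ofReal ((1 - Real.exp (-f p)) * p.1 ^ (ρ + 1)) := by
    have := hf.measurable
    fun_prop
  have hsl : IntegrableOn (sliceIntegral ρ h) (Set.Ioi 0) := by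
    have h1 : IntegrableOn (sliceIntegral ρ h) (Set.Ioc 0 K) :=
      ((hh.continuous_sliceIntegral hρ).integrableOn_Icc (a := 0) (b := K)).mono_set
        Set.Ioc_subset_Icc_self
    refine h1.of_forall_sdiff_eq_zero measurableSet_Ioi ?_
    rintro x ⟨hx, hx'⟩
    refine hh.sliceIntegral_eq_zero ?_
    by_contra hlt
    exact hx' ⟨hx, (not_le.1 hlt).le⟩
  rw [intensityIntegral, hrestr, lintegral_prod _ hmeas.aemeasurable,
    ofReal_integral_eq_lintegral_ofReal hsl]
  · refine setLIntegral_congr_fun measurableSet_Ioi fun x hx => ?_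
    have hx' : (0 : ℝ) < x := hx
    have hxp : 0 ≤ x ^ (ρ + 1) := by positivity
    simp only
    rw [sliceIntegral, ← integral_const_mul, ofReal_integral_eq_lintegral_ofReal
      ((hh.integrableOn_slice x).const_mul _)
      (Eventually.of_forall fun v => mul_nonneg hxp (hh.nonneg x v))]
    simp only [mul_comm (x ^ (ρ + 1)), hhdef]
  · filter_upwards [ae_restrict_mem measurableSet_Ioi] with x hx
    exact hh.sliceIntegral_nonneg (le_of_lt hx)

theorem limitW_rpow (E : ℕ → Ω → ℝ) (ω : Ω) :
    limitW E ω ^ (-ρ) = Real.exp (ρ * limitM E ω) := by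
  rw [limitW, ← Real.exp_mul]
  ring_nf

theorem tendsto_laplaceFunctional_of_isDominated [IsProbabilityMeasure μ] (hρ : 0 < ρ)
    (hE : ∀ i, Measurable (E i)) (hlaw : ∀ i, HasLaw (E i) (expMeasure 1) μ)
    (hindep : iIndepFun E μ) (hf0 : ∀ p, 0 ≤ f p) (hfc : Continuous f)
    (hfK : ∀ x v, K ≤ x → f (x, v) = 0)
    (hh : IsDominated (fun x v => 1 - Real.exp (-f (x, v))) H K) :
    Tendsto (fun n : ℕ => laplaceFunctional μ (pointProcess ρ E n) f) atTop
      (𝓝 (∫ ω, expNeg (ENNReal.ofReal (limitW E ω ^ (-ρ) / ρ) * intensityIntegral ρ f) ∂μ)) := by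
  have key := hh.tendsto_integral_prod_pointFactor hρ hE hlaw hindep
  have hlim : ∀ ω, expNeg (ENNReal.ofReal (limitW E ω ^ (-ρ) / ρ) * intensityIntegral ρ f) =
      Real.exp (-(Real.exp (ρ * limitM E ω) / ρ *
        ∫ x in Set.Ioi 0, sliceIntegral ρ (fun x v => 1 - Real.exp (-f (x, v))) x)) := fun ω => by
    have h1 : 0 ≤ Real.exp (ρ * limitM E ω) / ρ := by positivity
    rw [intensityIntegral_eq hρ hh hfc, limitW_rpow, ← ENNReal.ofReal_mul h1, expNeg_ofReal]
    exact mul_nonneg h1 (setIntegral_nonneg measurableSet_Ioi fun x hx =>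
      hh.sliceIntegral_nonneg (le_of_lt hx))
  simp_rw [hlim]
  refine key.congr' ?_
  filter_upwards [eventually_gt_atTop 0] with n hn
  simp only [laplaceFunctional, expNeg_lintegral_pointProcess hf0 hfK hn]

/-- A continuous cutoff equal to `1` on `(-∞, j]` and to `0` on `[j + 1, ∞)`. -/
def cutoff (j : ℕ) (y : ℝ) : ℝ := max 0 (min 1 (j + 1 - y))

theorem cutoff_nonneg (j : ℕ) (y : ℝ) : 0 ≤ cutoff j y := le_max_left _ _

theorem cutoff_le_one (j : ℕ) (y : ℝ) : cutoff j y ≤ 1 := max_le zero_le_one (min_le_left _ _)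

theorem cutoff_mono (y : ℝ) : Monotone fun j => cutoff j y := fun i j hij => by
  have : (i : ℝ) ≤ j := by exact_mod_cast hij
  exact max_le_max le_rfl (min_le_min le_rfl (by linarith))

theorem cutoff_eq_one {j : ℕ} {y : ℝ} (h : y ≤ j) : cutoff j y = 1 := by
  rw [cutoff, min_eq_left (by linarith), max_eq_right zero_le_one]

theorem cutoff_eq_zero {j : ℕ} {y : ℝ} (h : (j : ℝ) + 1 < y) : cutoff j y = 0 :=
  max_eq_left ((min_le_right _ _).trans (by linarith))

theorem continuous_cutoff (j : ℕ) : Continuous (cutoff j) := by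
  unfold cutoff
  fun_prop

/-- Truncation in `y` supplies an envelope, the indicator of `y ≤ j + 1`, without any condition on
derivatives. -/
theorem isDominated_cutoff (hf0 : ∀ p, 0 ≤ f p) (hfc : Continuous f) (hK : 0 < K)
    (hfK : ∀ x v, K ≤ x → f (x, v) = 0) (j : ℕ) :
    IsDominated (fun x v => 1 - Real.exp (-(f (x, v) * cutoff j v)))
      ((Set.Iic ((j : ℝ) + 1)).indicator 1) K where
  continuous := by
    have := continuous_cutoff j
    simp only [Function.uncurry_def]
    fun_prop
  nonneg x v := by
    rw [sub_nonneg, Real.exp_le_one_iff, neg_nonpos]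
    exact mul_nonneg (hf0 _) (cutoff_nonneg _ _)
  le_one x v := sub_le_self _ (Real.exp_pos _).le
  le_bound x v _ := by
    by_cases hv : v ∈ Set.Iic ((j : ℝ) + 1)
    · rw [Set.indicator_of_mem hv]
      exact sub_le_self _ (Real.exp_pos _).le
    · rw [Set.indicator_of_notMem hv, cutoff_eq_zero (not_le.1 hv)]
      simp
  integrable := by
    rw [IntegrableOn, integrable_indicator_iff measurableSet_Iic, IntegrableOn,
      Measure.restrict_restrict measurableSet_Iic, Set.Iic_inter_Ioi]
    exact (continuous_const.integrableOn_Ioc :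
      IntegrableOn (fun _ => (1 : ℝ)) (Set.Ioc 0 ((j : ℝ) + 1)))
  tendsto_bound := by
    refine (tendsto_const_nhds (x := (0 : ℝ))).congr' ?_
    filter_upwards [eventually_gt_atTop ((j : ℝ) + 1)] with v hv
    rw [Set.indicator_of_notMem (by simpa using hv)]
  pos := hK
  eq_zero x v hx := by simp [hfK x v hx]

theorem tendsto_intensityIntegral_cutoff (hf0 : ∀ p, 0 ≤ f p) (hfc : Continuous f) :
    Tendsto (fun j : ℕ => intensityIntegral ρ fun p => f p * cutoff j p.2) atTop
      (𝓝 (intensityIntegral ρ f)) := by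
  refine lintegral_tendsto_of_tendsto_of_monotone (fun j => ?_) ?_ ?_
  · have h1 := hfc.measurable
    have h2 := (continuous_cutoff j).measurable
    refine Measurable.aemeasurable ?_
    fun_prop
  · filter_upwards [ae_restrict_mem (measurableSet_Ici.prod measurableSet_Ici)] with p hp
    intro i j hij
    refine ENNReal.ofReal_le_ofReal (mul_le_mul_of_nonneg_right ?_ (Real.rpow_nonneg hp.1 _))
    refine sub_le_sub_left (Real.exp_le_exp.2 (neg_le_neg ?_)) 1
    exact mul_le_mul_of_nonneg_left (cutoff_mono p.2 hij) (hf0 p)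
  · refine Eventually.of_forall fun p => ?_
    refine tendsto_const_nhds.congr' ?_
    filter_upwards [tendsto_natCast_atTop_atTop.eventually_ge_atTop p.2] with j hj
    rw [cutoff_eq_one hj, mul_one]

/-- Truncating `f` only increases the Laplace functional. The limit for the `j`-th truncation is
known, and it tends to `0` as `j → ∞` because the truncated intensities increase to `∞` by monotone
convergence. -/
theorem tendsto_laplaceFunctional_of_eq_top [IsProbabilityMeasure μ] (hρ : 0 < ρ)
    (hE : ∀ i, Measurable (E i)) (hlaw : ∀ i, HasLaw (E i) (expMeasure 1) μ)
    (hindep : iIndepFun E μ) (hf0 : ∀ p, 0 ≤ f p) (hfc : Continuous f) (hK : 0 < K)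
    (hfK : ∀ x v, K ≤ x → f (x, v) = 0) (htop : intensityIntegral ρ f = ∞) :
    Tendsto (fun n : ℕ => laplaceFunctional μ (pointProcess ρ E n) f) atTop (𝓝 0) := by
  set g : ℕ → ℝ × ℝ → ℝ := fun j p => f p * cutoff j p.2 with hg
  have hg0 : ∀ j p, 0 ≤ g j p := fun j p => mul_nonneg (hf0 p) (cutoff_nonneg _ _)
  have hgc : ∀ j, Continuous (g j) := fun j =>
    hfc.mul ((continuous_cutoff j).comp continuous_snd)
  have hgK : ∀ j x v, K ≤ x → g j (x, v) = 0 := fun j x v hx => by simp [hg, hfK x v hx]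
  have hgd : ∀ j, IsDominated (fun x v => 1 - Real.exp (-g j (x, v))) _ K := fun j =>
    isDominated_cutoff hf0 hfc hK hfK j
  have hM : AEMeasurable (limitM E) μ := by
    refine aemeasurable_of_tendsto_metrizable_ae atTop (fun n => ?_)
      (ae_tendsto_martingaleM hE hlaw hindep)
    exact (((measurable_splitTime_past hE n).mono ((past E hE).le n) le_rfl).sub_const
      _).aemeasurable
  have hlim : Tendsto (fun j => ∫ ω, expNeg (ENNReal.ofReal (limitW E ω ^ (-ρ) / ρ) *
      intensityIntegral ρ (g j)) ∂μ) atTop (𝓝 0) := by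
    set r : ℕ → ℝ := fun j => ∫ x in Set.Ioi 0,
      sliceIntegral ρ (fun x v => 1 - Real.exp (-g j (x, v))) x with hr
    have hr0 : ∀ j, 0 ≤ r j := fun j => setIntegral_nonneg measurableSet_Ioi fun x hx =>
      (hgd j).sliceIntegral_nonneg (le_of_lt hx)
    have hrtop : Tendsto r atTop atTop := by
      have h1 := tendsto_intensityIntegral_cutoff (ρ := ρ) hf0 hfc
      rw [htop] at h1
      refine tendsto_atTop.2 fun b => ?_
      filter_upwards [h1.eventually_const_lt (ENNReal.ofReal_lt_top (r := b))] with j hj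
      change _ < intensityIntegral ρ (g j) at hj
      rw [intensityIntegral_eq hρ (hgd j) (hgc j)] at hj
      exact le_of_not_gt fun hlt => absurd hj (not_lt.2 (ENNReal.ofReal_le_ofReal hlt.le))
    have heq : ∀ j ω, expNeg (ENNReal.ofReal (limitW E ω ^ (-ρ) / ρ) *
        intensityIntegral ρ (g j)) = Real.exp (-(Real.exp (ρ * limitM E ω) / ρ * r j)) :=
      fun j ω => by
        have h1 : 0 ≤ Real.exp (ρ * limitM E ω) / ρ := by positivity
        rw [intensityIntegral_eq hρ (hgd j) (hgc j), limitW_rpow, ← ENNReal.ofReal_mul h1,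
          expNeg_ofReal (mul_nonneg h1 (hr0 j))]
    simp_rw [heq]
    rw [← integral_zero Ω ℝ (μ := μ)]
    refine tendsto_integral_of_dominated_convergence (fun _ => 1) (fun j => ?_)
      (integrable_const 1) (fun j => Eventually.of_forall fun ω => ?_)
      (Eventually.of_forall fun ω => ?_)
    · exact (((hM.const_mul ρ).exp.div_const ρ).mul_const _).neg.exp.aestronglyMeasurable
    · rw [Real.norm_of_nonneg (Real.exp_pos _).le, Real.exp_le_one_iff, neg_nonpos]
      have := hr0 j
      positivity
    · exact Real.tendsto_exp_neg_atTop_nhds_zero.comp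
        (hrtop.const_mul_atTop (by positivity : 0 < Real.exp (ρ * limitM E ω) / ρ))
  have hle : ∀ j n, 0 < n → laplaceFunctional μ (pointProcess ρ E n) f ≤
      laplaceFunctional μ (pointProcess ρ E n) (g j) := fun j n hn => by
    simp only [laplaceFunctional]
    refine integral_mono_of_nonneg (Eventually.of_forall fun ω => expNeg_nonneg _) ?_
      (Eventually.of_forall fun ω => ?_)
    · simp only [expNeg_lintegral_pointProcess (hg0 j) (hgK j) hn]
      refine Integrable.of_bound (C := 1) ((Finset.measurable_fun_prod _ fun i _ =>
        ((hgd j).measurable_pointFactor hE n i).mono ((past E hE).le _)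
          le_rfl).aestronglyMeasurable) (Eventually.of_forall fun ω => ?_)
      rw [Real.norm_of_nonneg (Finset.prod_nonneg fun i _ => ((hgd j).pointFactor_mem n i ω).1)]
      exact Finset.prod_le_one (fun i _ => ((hgd j).pointFactor_mem n i ω).1)
        fun i _ => ((hgd j).pointFactor_mem n i ω).2
    · simp only [expNeg_lintegral_pointProcess (hg0 j) (hgK j) hn,
        expNeg_lintegral_pointProcess hf0 hfK hn, pointFactor, sub_sub_cancel]
      refine Finset.prod_le_prod (fun i _ => (Real.exp_pos _).le) fun i _ => ?_
      refine Real.exp_le_exp.2 (neg_le_neg ?_)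
      exact mul_le_of_le_one_right (hf0 _) (cutoff_le_one _ _)
  rw [Metric.tendsto_nhds]
  intro ε hε
  obtain ⟨j, hj⟩ := (hlim.eventually_lt_const hε).exists
  filter_upwards [eventually_gt_atTop 0, (tendsto_laplaceFunctional_of_isDominated hρ hE hlaw
    hindep (hg0 j) (hgc j) (hgK j) (hgd j)).eventually_lt_const hj] with n hn hn2
  rw [Real.dist_0_eq_abs, laplaceFunctional, abs_of_nonneg (integral_nonneg fun ω => expNeg_nonneg _)]
  exact (hle j n hn).trans_lt hn2

end Laplace

/-! ### An integrable envelope from the derivative condition -/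

section Envelope

/-- A supremum over uncountably many `x` need not be measurable. A measurable `g ≤ G` with the same
lower integral serves instead: `max w g` is still a.e. below `G`, so its integral cannot exceed that
of `g`, which forces `w ≤ g` a.e. -/
theorem exists_measurable_forall_ae_le {α : Type*} [MeasurableSpace α] (ν : Measure α)
    (G : α → ℝ≥0∞) (hG : ∫⁻ y, G y ∂ν ≠ ∞) :
    ∃ g : α → ℝ≥0∞, Measurable g ∧ ∫⁻ y, g y ∂ν ≠ ∞ ∧
      ∀ w : α → ℝ≥0∞, Measurable w → (∀ᵐ y ∂ν, w y ≤ G y) → w ≤ᵐ[ν] g := by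
  obtain ⟨g, hgm, hgG, hgint⟩ := exists_measurable_le_lintegral_eq ν G
  refine ⟨g, hgm, hgint ▸ hG, fun w hwm hw => ?_⟩
  have h1 : g =ᵐ[ν] fun y => max (w y) (g y) := by
    refine ae_eq_of_ae_le_of_lintegral_le (Eventually.of_forall fun y => le_max_right _ _)
      (hgint ▸ hG) (hwm.max hgm).aemeasurable ?_
    rw [← hgint]
    refine lintegral_mono_ae ?_
    filter_upwards [hw] with y hy
    exact max_le hy (hgG y)
  filter_upwards [h1] with y hy
  rw [hy]
  exact le_max_left _ _

/-- Tonelli: `∫ (∫_{z > y} k(z) dz) dy = ∫ z k(z) dz` over `(0, ∞)`. -/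
theorem lintegral_tail {k : ℝ → ℝ≥0∞} (hk : Measurable k) :
    ∫⁻ y in Set.Ioi (0 : ℝ), ∫⁻ z in Set.Ioi y, k z =
      ∫⁻ z in Set.Ioi (0 : ℝ), ENNReal.ofReal z * k z := by
  have h1 : ∀ y ∈ Set.Ioi (0 : ℝ), ∫⁻ z in Set.Ioi y, k z =
      ∫⁻ z in Set.Ioi (0 : ℝ), (Set.Ioi y).indicator k z := fun y hy => by
    rw [lintegral_indicator measurableSet_Ioi, Measure.restrict_restrict measurableSet_Ioi,
      Set.inter_eq_left.2 (Set.Ioi_subset_Ioi (le_of_lt hy))]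
  rw [setLIntegral_congr_fun measurableSet_Ioi h1, lintegral_lintegral_swap]
  · refine setLIntegral_congr_fun measurableSet_Ioi fun z hz => ?_
    have h2 : ∀ y, (Set.Ioi y).indicator k z = (Set.Iio z).indicator (fun _ => k z) y := fun y => by
      simp only [Set.indicator, Set.mem_Ioi, Set.mem_Iio]
    simp only [h2]
    rw [lintegral_indicator measurableSet_Iio, Measure.restrict_restrict measurableSet_Iio,
      setLIntegral_const, Set.inter_comm, Set.Ioi_inter_Iio, Real.volume_Ioo, sub_zero, mul_comm]
  · have : Function.uncurry (fun y z => (Set.Ioi y).indicator k z) =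
        {p : ℝ × ℝ | p.1 < p.2}.indicator fun p => k p.2 := by
      ext ⟨y, z⟩
      simp [Set.indicator, Function.uncurry]
    rw [this]
    exact ((hk.comp measurable_snd).indicator
      (measurableSet_lt measurable_fst measurable_snd)).aemeasurable

theorem enorm_sub_le_lintegral_deriv {φ : ℝ → ℝ} (hφ : DifferentiableOn ℝ φ (Set.Ici 0))
    {k : ℝ → ℝ≥0∞} (hk : ∀ᵐ y ∂(volume.restrict (Set.Ioi (0 : ℝ))), ‖deriv φ y‖ₑ ≤ k y)
    {y y' : ℝ} (hy : 0 < y) (hyy' : y ≤ y') (hfin : ∫⁻ z in Set.Ioi y, k z ≠ ∞) :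
    ‖φ y' - φ y‖ₑ ≤ ∫⁻ z in Set.Ioi y, k z := by
  have hd : ∀ z, 0 < z → HasDerivAt φ (deriv φ z) z := fun z hz =>
    ((hφ z hz.le).differentiableAt (Ici_mem_nhds hz)).hasDerivAt
  have hle : ∫⁻ z in Set.Ioc y y', ‖deriv φ z‖ₑ ≤ ∫⁻ z in Set.Ioi y, k z := by
    refine (lintegral_mono_ae ?_).trans (lintegral_mono_set Set.Ioc_subset_Ioi_self)
    exact ae_restrict_of_ae_restrict_of_subset
      (fun z hz => hy.trans hz.1 : Set.Ioc y y' ⊆ Set.Ioi 0) hk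
  have hint : IntegrableOn (deriv φ) (Set.Ioc y y') :=
    ⟨(measurable_deriv φ).aestronglyMeasurable, hle.trans_lt hfin.lt_top⟩
  have hFTC := intervalIntegral.integral_eq_sub_of_hasDerivAt (f := φ) (f' := deriv φ)
    (a := y) (b := y') (fun z hz => by
      rw [Set.uIcc_of_le hyy'] at hz
      exact hd z (hy.trans_le hz.1)) ((intervalIntegrable_iff_integrableOn_Ioc_of_le hyy').2 hint)
  rw [← hFTC, intervalIntegral.integral_of_le hyy']
  exact (enorm_integral_le_lintegral_enorm _).trans hle

theorem measurable_lintegral_Ioi (k : ℝ → ℝ≥0∞) : Measurable fun y => ∫⁻ z in Set.Ioi y, k z :=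
  Antitone.measurable fun _ _ h => lintegral_mono_set (Set.Ioi_subset_Ioi h)

/-- The integrand is bounded below by a positive constant on a product set of infinite area; `0 < a`
keeps the weight `x^{ρ+1}` away from `0`. -/
theorem intensityIntegral_eq_top {ρ : ℝ} (hρ : 0 < ρ) {f : ℝ × ℝ → ℝ} {a b y η : ℝ}
    (ha : 0 < a) (hab : a < b) (hy : 0 ≤ y) (hη : 0 < η)
    (hf : ∀ x ∈ Set.Ioo a b, ∀ v ∈ Set.Ioi y, η ≤ f (x, v)) : intensityIntegral ρ f = ∞ := by
  set C := ENNReal.ofReal ((1 - Real.exp (-η)) * a ^ (ρ + 1)) with hC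
  have hC0 : C ≠ 0 := by
    have h1 : Real.exp (-η) < 1 := Real.exp_lt_one_iff.2 (by linarith)
    have h2 : 0 < a ^ (ρ + 1) := by positivity
    rw [hC, ne_eq, ENNReal.ofReal_eq_zero, not_le]
    exact mul_pos (by linarith) h2
  have hvol : volume (Set.Ioo a b ×ˢ Set.Ioi y) = ∞ := by
    rw [Measure.volume_eq_prod, Measure.prod_prod, Real.volume_Ioi, Real.volume_Ioo]
    exact ENNReal.mul_top (by simpa using hab)
  rw [eq_top_iff]
  calc (∞ : ℝ≥0∞) = ∫⁻ _ in Set.Ioo a b ×ˢ Set.Ioi y, C := by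
        rw [setLIntegral_const, hvol, ENNReal.mul_top hC0]
    _ ≤ ∫⁻ p in Set.Ioo a b ×ˢ Set.Ioi y,
          ENNReal.ofReal ((1 - Real.exp (-f p)) * p.1 ^ (ρ + 1)) := by
        refine setLIntegral_mono' (measurableSet_Ioo.prod measurableSet_Ioi) fun p hp => ?_
        have h1 := hf p.1 hp.1 p.2 hp.2
        have h2 : Real.exp (-f p) ≤ Real.exp (-η) := Real.exp_le_exp.2 (neg_le_neg h1)
        have h3 : Real.exp (-η) < 1 := Real.exp_lt_one_iff.2 (by linarith)
        have h4 : a ^ (ρ + 1) ≤ p.1 ^ (ρ + 1) :=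
          Real.rpow_le_rpow ha.le hp.1.1.le (by positivity)
        refine ENNReal.ofReal_le_ofReal (mul_le_mul (by linarith) h4 (by positivity) ?_)
        linarith
    _ ≤ intensityIntegral ρ f :=
        lintegral_mono_set (Set.prod_mono (fun x hx => (ha.trans hx.1).le)
          fun v hv => hy.trans (le_of_lt hv))

/-- Extension of a function on the quadrant to the plane, constant along the projection. -/
def extend (f : ℝ × ℝ → ℝ) (p : ℝ × ℝ) : ℝ := f (max p.1 0, max p.2 0)

theorem extend_eq {f : ℝ × ℝ → ℝ} {p : ℝ × ℝ} (hp : p ∈ quadrant) : extend f p = f p := by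
  rw [extend, max_eq_left hp.1, max_eq_left hp.2]

theorem proj_mem_quadrant (p : ℝ × ℝ) : (max p.1 0, max p.2 0) ∈ quadrant :=
  Set.mk_mem_prod (le_max_right p.1 0) (le_max_right p.2 0)

theorem continuous_extend {f : ℝ × ℝ → ℝ} (hf : ContinuousOn f quadrant) :
    Continuous (extend f) :=
  hf.comp_continuous (by fun_prop) proj_mem_quadrant

theorem intensityIntegral_extend (ρ : ℝ) (f : ℝ × ℝ → ℝ) :
    intensityIntegral ρ (extend f) = intensityIntegral ρ f :=
  setLIntegral_congr_fun (measurableSet_Ici.prod measurableSet_Ici) fun p hp => by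
    rw [extend_eq hp]

/-- Pointwise domination of `f` by the tail of its `y`-derivative, when the limiting intensity is
finite. -/
theorem le_toReal_tail {ρ : ℝ} (hρ : 0 < ρ) {f : ℝ × ℝ → ℝ}
    (hf_cont : ContinuousOn f quadrant)
    (hfin : intensityIntegral ρ f ≠ ∞) {τ : ℝ → ℝ≥0∞} {y : ℝ} (hy : 0 < y) (hτ : τ y ≠ ∞)
    (hosc : ∀ x, 0 ≤ x → ∀ y', y ≤ y' → ‖f (x, y') - f (x, y)‖ₑ ≤ τ y) {x : ℝ} (hx : 0 ≤ x) :
    f (x, y) ≤ (τ y).toReal := by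
  by_contra! hlt
  obtain ⟨η, hη, hη2⟩ : ∃ η > 0, (τ y).toReal + η < f (x, y) :=
    ⟨(f (x, y) - (τ y).toReal) / 2, by linarith, by linarith⟩
  have hcont : Continuous fun x' => extend f (x', y) :=
    (continuous_extend hf_cont).comp (Continuous.prodMk_left y)
  have hnear : ∀ᶠ x' in 𝓝 x, (τ y).toReal + η < extend f (x', y) := by
    refine hcont.tendsto x |>.eventually_const_lt ?_
    rwa [extend_eq (Set.mk_mem_prod hx hy.le)]
  obtain ⟨δ, hδ, hball⟩ := Metric.eventually_nhds_iff.1 hnear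
  -- The strip is taken to the right of `x`, starting at `x + δ / 2`, so that its left end is
  -- positive even for `x = 0`.
  refine hfin (intensityIntegral_eq_top hρ (a := x + δ / 2) (b := x + δ) (y := y) (η := η)
    (by positivity) (by linarith) hy.le hη fun x' hx' v hv => ?_)
  have hx'0 : 0 ≤ x' := by linarith [hx'.1]
  have h1 : (τ y).toReal + η < f (x', y) := by
    have := hball (y := x') (by
      rw [Real.dist_eq, abs_of_nonneg (by linarith [hx'.1])]; linarith [hx'.2])
    rwa [extend_eq (Set.mk_mem_prod hx'0 hy.le)] at this
  have h2 := ENNReal.toReal_mono hτ (hosc x' hx'0 v (le_of_lt hv))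
  rw [toReal_enorm, Real.norm_eq_abs] at h2
  linarith [(abs_le.1 h2).1]

/-- The envelope is the tail `τ(y) = ∫_{z > y} k(z) dz`, where `z k(z) = g(z)` dominates `z` times
each derivative. Tonelli gives `∫ τ = ∫ g < ∞`, and a Markov-type bound `τ(y) ≤ C / y` gives
finiteness and decay. Finally `1 - exp (-f) ≤ f ≤ τ`. -/
theorem exists_isDominated {ρ K : ℝ} (hρ : 0 < ρ) (hK : 0 < K) {f : ℝ × ℝ → ℝ}
    (hf_nonneg : ∀ p ∈ quadrant, 0 ≤ f p) (hf_cont : ContinuousOn f quadrant)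
    (hf_supp : ∀ p ∈ quadrant, K ≤ p.1 → f p = 0)
    (hf_diff : ∀ x : ℝ, 0 ≤ x → DifferentiableOn ℝ (fun y => f (x, y)) (Set.Ici 0))
    (hf_int : ∫⁻ y in Set.Ici (0 : ℝ), ENNReal.ofReal y * supDeriv f y < ∞)
    (hfin : intensityIntegral ρ f ≠ ∞) :
    ∃ H, IsDominated (fun x v => 1 - Real.exp (-extend f (x, v))) H K := by
  -- Dropping the null point `0` removes the one-sided derivative there and allows division by `y`.
  rw [← Measure.restrict_congr_set (Ioi_ae_eq_Ici (μ := (volume : Measure ℝ)) (a := 0))] at hf_int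
  obtain ⟨g, hgm, hgint, hg⟩ := exists_measurable_forall_ae_le
    (volume.restrict (Set.Ioi (0 : ℝ))) _ hf_int.ne
  set k : ℝ → ℝ≥0∞ := fun y => g y / ENNReal.ofReal y with hk
  have hkm : Measurable k := hgm.div ENNReal.measurable_ofReal
  have hkg : ∀ z, 0 < z → ENNReal.ofReal z * k z = g z := fun z hz =>
    ENNReal.mul_div_cancel (by simpa using hz) ENNReal.ofReal_ne_top
  set τ : ℝ → ℝ≥0∞ := fun y => ∫⁻ z in Set.Ioi y, k z with hτ
  set C := ∫⁻ z in Set.Ioi (0 : ℝ), g z with hC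
  have hτint : ∫⁻ y in Set.Ioi (0 : ℝ), τ y = C := by
    rw [hτ, lintegral_tail hkm]
    exact setLIntegral_congr_fun measurableSet_Ioi fun z hz => hkg z hz
  have hτC : ∀ y, 0 < y → τ y ≤ C / ENNReal.ofReal y := fun y hy => by
    have hy0 : ENNReal.ofReal y ≠ 0 := by simpa using hy
    rw [ENNReal.le_div_iff_mul_le (Or.inl hy0) (Or.inl ENNReal.ofReal_ne_top), mul_comm,
      ← lintegral_const_mul _ hkm]
    refine le_trans ?_ (lintegral_mono_set (Set.Ioi_subset_Ioi hy.le))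
    refine setLIntegral_mono' measurableSet_Ioi fun z hz => ?_
    rw [← hkg z (hy.trans hz)]
    gcongr
    exact le_of_lt hz
  have hτfin : ∀ y, 0 < y → τ y ≠ ∞ := fun y hy =>
    ((hτC y hy).trans_lt (ENNReal.div_lt_top hgint (by simpa using hy))).ne
  have hderiv : ∀ x, 0 ≤ x → ∀ᵐ y ∂(volume.restrict (Set.Ioi (0 : ℝ))),
      ‖deriv (fun y => f (x, y)) y‖ₑ ≤ k y := fun x hx => by
    have h1 := hg (fun y => ENNReal.ofReal y * ‖deriv (fun y => f (x, y)) y‖ₑ)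
      (ENNReal.measurable_ofReal.mul (measurable_deriv _).enorm) (by
        filter_upwards [ae_restrict_mem measurableSet_Ioi] with y hy
        rw [← derivWithin_of_mem_nhds (Ici_mem_nhds hy)]
        gcongr
        exact le_iSup₂_of_le (f := fun x (_ : x ∈ Set.Ici (0 : ℝ)) =>
          ‖derivWithin (fun z => f (x, z)) (Set.Ici 0) y‖ₑ) x hx le_rfl)
    filter_upwards [h1, ae_restrict_mem measurableSet_Ioi] with y hy hy0
    have hy0' : ENNReal.ofReal y ≠ 0 := by simpa using hy0
    rw [hk, ENNReal.le_div_iff_mul_le (Or.inl hy0') (Or.inl ENNReal.ofReal_ne_top), mul_comm]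
    exact hy
  have hbound : ∀ x v, 0 < v → extend f (x, v) ≤ (τ v).toReal := fun x v hv => by
    have h1 := le_toReal_tail hρ hf_cont hfin hv (hτfin v hv)
      (fun x hx y' hy' => enorm_sub_le_lintegral_deriv (hf_diff x hx) (hderiv x hx) hv hy'
        (hτfin v hv)) (le_max_right x 0)
    rw [extend]
    simpa only [max_eq_left hv.le] using h1
  have hf0 : ∀ p, 0 ≤ extend f p := fun p => hf_nonneg _ (proj_mem_quadrant p)
  have hfc := continuous_extend hf_cont
  refine ⟨fun v => (τ v).toReal, ?_, fun x v => ?_, fun x v => ?_, fun x v hv => ?_, ?_, ?_, hK,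
    fun x v hx => ?_⟩
  · simp only [Function.uncurry_def]
    fun_prop
  · rw [sub_nonneg, Real.exp_le_one_iff, neg_nonpos]
    exact hf0 _
  · exact sub_le_self _ (Real.exp_pos _).le
  · refine le_trans ?_ (hbound x v hv)
    linarith [Real.add_one_le_exp (-extend f (x, v))]
  · exact integrable_toReal_of_lintegral_ne_top (measurable_lintegral_Ioi k).aemeasurable
      (hτint.trans_ne hgint)
  · refine squeeze_zero' (Eventually.of_forall fun v => ENNReal.toReal_nonneg) ?_
      (tendsto_const_nhds.div_atTop tendsto_id : Tendsto (fun y : ℝ => C.toReal / y) atTop (𝓝 0))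
    filter_upwards [eventually_gt_atTop 0] with v hv
    have h1 := ENNReal.toReal_mono
      (ENNReal.div_lt_top hgint (by simpa using hv)).ne (hτC v hv)
    rwa [ENNReal.toReal_div, ENNReal.toReal_ofReal hv.le] at h1
  · have : extend f (x, v) = 0 := hf_supp _ (proj_mem_quadrant _) (hx.trans (le_max_left _ _))
    simp [this]

end Envelope

/-! ### Measurable nonnegative versions of the variables -/

section Modification

variable {Ω : Type*} {E : ℕ → Ω → ℝ}

/-- `HasLaw` only gives a.e. measurability, while the filtration needs measurable variables.
Nonnegativity everywhere keeps all points in the quadrant, where `f` and `extend f` agree. -/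
theorem exists_measurable_nonneg_modification [MeasurableSpace Ω] {μ : Measure Ω}
    (hlaw : ∀ i, HasLaw (E i) (expMeasure 1) μ) :
    ∃ E' : ℕ → Ω → ℝ, (∀ i, Measurable (E' i)) ∧ (∀ i ω, 0 ≤ E' i ω) ∧
      ∀ i, E i =ᵐ[μ] E' i := by
  refine ⟨fun i ω => |(hlaw i).aemeasurable.mk (E i) ω|,
    fun i => (hlaw i).aemeasurable.measurable_mk.abs, fun i ω => abs_nonneg _, fun i => ?_⟩
  have hpos : ∀ᵐ ω ∂μ, 0 < E i ω := by
    have := ae_expMeasure_one_pos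
    rw [← (hlaw i).map_eq] at this
    exact ae_of_ae_map (hlaw i).aemeasurable this
  filter_upwards [hpos, (hlaw i).aemeasurable.ae_eq_mk] with ω h1 h2
  rw [← h2, abs_of_pos h1]

theorem binProb_nonneg {ρ : ℝ} (hρ : 0 < ρ) {ω : Ω} (hE : ∀ i, 0 ≤ E i ω) (i : ℕ) :
    0 ≤ binProb ρ E i ω := by
  rw [binProb, sub_nonneg, Real.exp_le_exp, splitTime_succ, neg_le_neg_iff]
  have := hE i
  refine mul_le_mul_of_nonneg_left ?_ hρ.le
  have : 0 ≤ E i ω / ((i : ℝ) + 1) := by positivity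
  linarith

theorem lintegral_pointProcess_extend {ρ : ℝ} (hρ : 0 < ρ) {ω : Ω} (hE : ∀ i, 0 ≤ E i ω) (n : ℕ)
    (f : ℝ × ℝ → ℝ) :
    ∫⁻ p, ENNReal.ofReal (extend f p) ∂(pointProcess ρ E n ω) =
      ∫⁻ p, ENNReal.ofReal (f p) ∂(pointProcess ρ E n ω) := by
  simp only [pointProcess, lintegral_sum_measure, lintegral_dirac]
  refine tsum_congr fun i => ?_
  rw [extend_eq]
  exact ⟨by simp only [Set.mem_Ici]; positivity,
    mul_nonneg (Nat.cast_nonneg n) (binProb_nonneg hρ hE i)⟩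

end Modification

end YuleBins

end

theorem mainTheorem9 {Ω : Type*} [MeasurableSpace Ω] (μ : Measure Ω) [IsProbabilityMeasure μ]
    (ρ : ℝ) (hρ : 0 < ρ)
    (E : ℕ → Ω → ℝ) (hlaw : ∀ i, HasLaw (E i) (expMeasure 1) μ) (hindep : iIndepFun E μ)
    (f : ℝ × ℝ → ℝ)
    (hf_nonneg : ∀ p ∈ YuleBins.quadrant, 0 ≤ f p)
    (hf_cont : ContinuousOn f YuleBins.quadrant)
    (hf_supp : ∃ K : ℝ, ∀ p ∈ YuleBins.quadrant, K ≤ p.1 → f p = 0)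
    (hf_diff : ∀ x : ℝ, 0 ≤ x → DifferentiableOn ℝ (fun y => f (x, y)) (Set.Ici 0))
    (hf_int : ∫⁻ y in Set.Ici (0 : ℝ), ENNReal.ofReal y * YuleBins.supDeriv f y < ∞) :
    (∀ᵐ ω ∂μ, Tendsto (fun n : ℕ => YuleBins.martingaleM E n ω) atTop
        (𝓝 (YuleBins.limitM E ω))) ∧
      Tendsto (fun n : ℕ => YuleBins.laplaceFunctional μ (YuleBins.pointProcess ρ E n) f) atTop
        (𝓝 (∫ ω, YuleBins.expNeg
          (ENNReal.ofReal (YuleBins.limitW E ω ^ (-ρ) / ρ) *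
            YuleBins.intensityIntegral ρ f) ∂μ)) := by
  open YuleBins in
  obtain ⟨E', hE'm, hE'0, hEE'⟩ := exists_measurable_nonneg_modification hlaw
  have hae : ∀ᵐ ω ∂μ, ∀ i, E i ω = E' i ω := ae_all_iff.2 hEE'
  have hlaw' : ∀ i, HasLaw (E' i) (expMeasure 1) μ := fun i => (hlaw i).congr (hEE' i).symm
  have hindep' : iIndepFun E' μ := hindep.congr hEE'
  have hsplit : ∀ ω, (∀ i, E i ω = E' i ω) → ∀ n, splitTime E n ω = splitTime E' n ω :=
    fun ω hω n => by simp only [splitTime, hω]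
  have hmart : ∀ ω, (∀ i, E i ω = E' i ω) → ∀ n, martingaleM E n ω = martingaleM E' n ω :=
    fun ω hω n => by simp only [martingaleM, hsplit ω hω]
  have hlim : ∀ ω, (∀ i, E i ω = E' i ω) → limitM E ω = limitM E' ω :=
    fun ω hω => by simp only [limitM, hmart ω hω]
  obtain ⟨K₀, hK₀⟩ := hf_supp
  -- The given bound may be nonpositive; enlarging it is harmless.
  have hK : 0 < max K₀ 1 := lt_of_lt_of_le one_pos (le_max_right _ _)
  have hfK : ∀ p ∈ quadrant, max K₀ 1 ≤ p.1 → f p = 0 := fun p hp h =>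
    hK₀ p hp ((le_max_left _ _).trans h)
  have hf0 : ∀ p, 0 ≤ extend f p := fun p => hf_nonneg _ (proj_mem_quadrant p)
  have hfc := continuous_extend hf_cont
  have hfK' : ∀ x v, max K₀ 1 ≤ x → extend f (x, v) = 0 := fun x v hx =>
    hfK _ (proj_mem_quadrant _) (hx.trans (le_max_left _ _))
  have hlap : ∀ n, laplaceFunctional μ (pointProcess ρ E n) f =
      laplaceFunctional μ (pointProcess ρ E' n) (extend f) := fun n => by
    refine integral_congr_ae ?_
    filter_upwards [hae] with ω hω
    have : pointProcess ρ E n ω = pointProcess ρ E' n ω := by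
      simp only [pointProcess, binProb, hsplit ω hω]
    simp only [this, lintegral_pointProcess_extend hρ (fun i => hE'0 i ω)]
  have hrhs : ∫ ω, expNeg (ENNReal.ofReal (limitW E ω ^ (-ρ) / ρ) * intensityIntegral ρ f) ∂μ =
      ∫ ω, expNeg (ENNReal.ofReal (limitW E' ω ^ (-ρ) / ρ) *
        intensityIntegral ρ (extend f)) ∂μ := by
    refine integral_congr_ae ?_
    filter_upwards [hae] with ω hω
    simp only [limitW, hlim ω hω, intensityIntegral_extend]
  refine ⟨?_, ?_⟩
  · filter_upwards [hae, ae_tendsto_martingaleM hE'm hlaw' hindep'] with ω hω h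
    rw [hlim ω hω]
    exact h.congr fun n => (hmart ω hω n).symm
  · simp_rw [hlap]
    rw [hrhs]
    -- If the intensity is infinite, the limit is `0` because `W_∞^{-ρ} / ρ` is positive; otherwise
    -- the derivative condition yields domination.
    by_cases hfin : intensityIntegral ρ f = ∞
    · rw [← intensityIntegral_extend] at hfin
      have h1 : ∀ ω, expNeg (ENNReal.ofReal (limitW E' ω ^ (-ρ) / ρ) *
          intensityIntegral ρ (extend f)) = 0 := fun ω => by
        have : 0 < limitW E' ω ^ (-ρ) / ρ := by
          rw [limitW_rpow]
          positivity
        rw [hfin, ENNReal.mul_top (by simpa using this), expNeg, if_pos rfl]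
      simp_rw [h1, integral_zero]
      exact tendsto_laplaceFunctional_of_eq_top hρ hE'm hlaw' hindep' hf0 hfc hK hfK' hfin
    · obtain ⟨H, hH⟩ := exists_isDominated hρ hK hf_nonneg hf_cont hfK hf_diff hf_int hfin
      exact tendsto_laplaceFunctional_of_isDominated hρ hE'm hlaw' hindep' hf0 hfc hfK' hH
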